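/- Let $d,m\ge 0$ be integers, $\frac14<\gamma\le\frac12$, $\gamma\neq\frac13$, and $\frac1\gamma+1<p\le\lfloor\frac1\gamma\rfloor+2$. Let $V:\mathbb R^m\to\mathcal L(\mathbb R^d,\mathbb R^m)$ be a $\mathrm{Lip}^p$ vector field: it is $\lfloor p\rfloor$ times continuously differentiable, its derivatives of the orders $1,\dots,\lfloor p\rfloor$ are bounded, and $D^{\lfloor p\rfloor}V$ is globally $(p-\lfloor p\rfloor)$-Hölder. Let $V_0:\mathbb R^m\to\mathbb R^m$ be $C^1$ with $\|V_0(z)\|\le P(\|z\|)$ for a polynomial $P$. Let $R$ be a real polynomial in two variables and $\Phi:\mathbb R\to\mathbb R$ a continuous function. A *geometric $\gamma$-rough path* is $\mathbf X=(X,\mathbb X^2,\mathbb X^3)$ with $X:\mathbb R\to\mathbb R^d$, and $\mathbb X^2,\mathbb X^3$ continuous functions on $\mathbb R\times\mathbb R$ with values in $(\mathbb R^d)^{\otimes2}$ and $(\mathbb R^d)^{\otimes3}$, such that, with $\delta X_{s,t}=X_t-X_s$, for all $s,u,t$ and all indices $$\mathbb X^2_{s,t}=\mathbb X^2_{s,u}+\mathbb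 X^2_{u,t}+\delta X_{s,u}\otimes\delta X_{u,t},\qquad \mathbb X^3_{s,t}=\mathbb X^3_{s,u}+\mathbb X^3_{u,t}+\mathbb X^2_{s,u}\otimes\delta X_{u,t}+\delta X_{s,u}\otimes\mathbb X^2_{u,t},$$ $$\mathbb X^{i,j}_{s,t}+\mathbb X^{j,i}_{s,t}=\delta X^i_{s,t}\,\delta X^j_{s,t},\qquad \sum_{\sigma\in S_3}\mathbb X^{i_{\sigma(1)},i_{\sigma(2)},i_{\sigma(3)}}_{s,t}=\delta X^{i_1}_{s,t}\,\delta X^{i_2}_{s,t}\,\delta X^{i_3}_{s,t},$$ and such that on every compact interval $I$ the norm $\|\mathbf X\|_{\gamma,I}=\max\{\|X\|_{\gamma,I},\|\mathbb X^2\|_{2\gamma,I}^{1/2},\|\mathbb X^3\|_{3\gamma,I}^{1/3}\}$ is finite. Here $\|A\|_{\alpha,I}=\sup_{s\ne t\in I}\|A_{s,t}\|/|t-s|^\alpha$ for a function $A$ of two times, and for a path $\xi$ we put $\|\xi\|_{\alpha,I}=\|\delta\xi\|_{\alpha,I}$, $\|\xi\|_{\infty,I}=\sup_I\|\xi\|$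 and $\|\xi\|_{C^\gamma,I}=\max\{\|\xi\|_{\infty,I},\|\xi\|_{\gamma,I}\}$. For a triple $(Y,Y^{(1)},Y^{(2)})$ of paths with values in $W$, $\mathcal L(\mathbb R^d,W)$ and $\mathcal L(\mathbb R^d\otimes\mathbb R^d,W)$ put $Y^\#_{s,t}=\delta Y_{s,t}-Y^{(1)}_s\delta X_{s,t}-Y^{(2)}_s\mathbb X^2_{s,t}$, $(Y^{(1)})^\#_{s,t}=\delta Y^{(1)}_{s,t}-Y^{(2)}_s\delta X_{s,t}$, and, with $\rho=\min\{3\gamma,1\}$ (so $\rho=3\gamma$ for $\gamma<\frac13$), $$|||(Y,Y^{(1)},Y^{(2)})|||_{\mathcal D^\gamma_{\mathbf X}(I)}=\max\{\|Y\|_{\infty,I},\|Y^{(1)}\|_{\infty,I},\|Y^{(2)}\|_{\infty,I},\|Y^{(2)}\|_{\gamma,I},\|(Y^{(1)})^\#\|_{2\gamma,I},\|Y^\#\|_{\rho,I}\}.$$ The triple is *controlled by $\mathbf X$ on $I$* if $Y,Y^{(1)},Y^{(2)}$ are $\gamma$-Hölder on $I$ and the last two entries of this maximum are finite. A *solution*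 of $$dZ_t=V(Z_t)\,d\mathbf X_t+V_0(Z_t)\,dt,\qquad Z_0=z_0, \qquad (*)$$ is a path $Z$ on $[0,\infty)$ such that $(Z,V(Z),D_ZV(V(Z)))$ is controlled by $\mathbf X$ on every $[0,T]$ and $Z_t=z_0+\int_0^tV(Z_\tau)\,d\mathbf X_\tau+\int_0^tV_0(Z_\tau)\,d\tau$ for all $t\ge0$. The rough integral is the limit, as the mesh of the partition $0=\tau_0<\dots<\tau_n=t$ tends to $0$, of $\sum_j\big(Y_{\tau_j}\delta X_{\tau_j,\tau_{j+1}}+Y^{(1)}_{\tau_j}\mathbb X^2_{\tau_j,\tau_{j+1}}+Y^{(2)}_{\tau_j}\mathbb X^3_{\tau_j,\tau_{j+1}}\big)$ with $Y=V(Z)$, $Y^{(1)}=D_ZV(V(Z))$ and $Y^{(2)}=D^2_ZV(V(Z),V(Z))+D_ZV(D_ZV(V(Z)))$. **Claim.** There are a real polynomial $Q$ in two variables and a continuous function $\Psi:\mathbb R\to\mathbb R$, depending only on $d,m,\gamma,p,V,V_0,P,R,\Phi$, with the following property. Let $\mathbf X$ be a geometric $\gamma$-rough path for which $(*)$ has,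 for every $z_0\in\mathbb R^m$, a unique solution $\phi_{\mathbf X}(z_0)$ on $[0,\infty)$, and for which $$\|\phi_{\mathbf X}(z_0)\|_{C^\gamma,[0,T]}\le\Phi(T)\,R(\|z_0\|,\|\mathbf X\|_{\gamma,[0,T]})\qquad\text{for all }z_0\in\mathbb R^m,\ T>0$$ (a negative right-hand side being read as $0$ here and below). Then for all $z_0\in\mathbb R^m$ and $T>0$ $$\Big|\Big|\Big|\big(\phi_{\mathbf X}(z_0),\,V(\phi_{\mathbf X}(z_0)),\,D_{\phi_{\mathbf X}(z_0)}V(V(\phi_{\mathbf X}(z_0)))\big)\Big|\Big|\Big|_{\mathcal D^\gamma_{\mathbf X}([0,T])}\le\Psi(T)\,Q(\|z_0\|,\|\mathbf X\|_{\gamma,[0,T]}).$$ If $\gamma>\frac13$, then with $Y=\phi_{\mathbf X}(z_0)$, $Y'=V(Y)$ and $I=[0,T]$ also the usual norm with one Gubinelli derivative, $\max\{\|Y\|_{\infty,I},\|Y'\|_{\infty,I},\|Y'\|_{\gamma,I},\|\delta Y-Y'\delta X\|_{2\gamma,I}\}$, is at most $\Psi(T)\,Q(\|z_0\|,\|\mathbf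 X\|_{\gamma,[0,T]})$. -/

import Mathlib

open scoped ENNReal

namespace RoughDE

/-- `ℝⁿ` with its Euclidean norm. -/
abbrev Vec (n : ℕ) : Type := EuclideanSpace ℝ (Fin n)

/-- `ℝᵈ ⊗ ℝᵈ` in the coordinates of the basis `eᵢ ⊗ eⱼ`. -/
abbrev Tensor2 (d : ℕ) : Type := EuclideanSpace ℝ (Fin d × Fin d)

/-- `ℝᵈ ⊗ ℝᵈ ⊗ ℝᵈ` in the coordinates of the basis `eᵢ ⊗ eⱼ ⊗ eₖ`. -/
abbrev Tensor3 (d : ℕ) : Type := EuclideanSpace ℝ (Fin d × Fin d × Fin d)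

/-- The `i`-th vector of the usual basis of `ℝᵈ`. -/
noncomputable def e {d : ℕ} (i : Fin d) : Vec d := EuclideanSpace.single i (1 : ℝ)

section Norms

variable {W : Type*} [NormedAddCommGroup W]

/-- The increment `δξ_{s,t} = ξ_t - ξ_s` of a path. -/
def incr (ξ : ℝ → W) (s t : ℝ) : W := ξ t - ξ s

/-- `sup_{s ∈ I} ‖ξ_s‖`, with the value `∞` if `ξ` is unbounded on `I`. -/
noncomputable def supNorm (I : Set ℝ) (ξ : ℝ → W) : ℝ≥0∞ :=
  ⨆ s ∈ I, ENNReal.ofReal ‖ξ s‖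

/-- `sup_{s, t ∈ I, s ≠ t} ‖A_{s,t}‖ / |t - s|^α` for a function `A` of two times, with the
value `∞` if these quotients are unbounded. For a path `ξ`, the `α`-Hölder seminorm is the
case `A = incr ξ`. -/
noncomputable def holderNorm (α : ℝ) (I : Set ℝ) (A : ℝ → ℝ → W) : ℝ≥0∞ :=
  ⨆ s ∈ I, ⨆ t ∈ I, ⨆ _ : s ≠ t, ENNReal.ofReal (‖A s t‖ / |t - s| ^ α)

/-- `‖ξ‖_{C^α, I}`, the maximum of the supremum norm and the `α`-Hölder seminorm. -/
noncomputable def cHolderNorm (α : ℝ) (I : Set ℝ) (ξ : ℝ → W) : ℝ≥0∞ :=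
  max (supNorm I ξ) (holderNorm α I (incr ξ))

end Norms

/-- A `γ`-rough path over `ℝᵈ` with three levels. -/
structure RoughPath (d : ℕ) (γ : ℝ) where
  /-- the underlying path -/
  X : ℝ → Vec d
  /-- the second Lévy area -/
  X2 : ℝ → ℝ → Tensor2 d
  /-- the third Lévy area -/
  X3 : ℝ → ℝ → Tensor3 d
  continuous_X2 : Continuous fun q : ℝ × ℝ => X2 q.1 q.2
  continuous_X3 : Continuous fun q : ℝ × ℝ => X3 q.1 q.2
  chen2 : ∀ (s u t : ℝ) (i j : Fin d),
    X2 s t (i, j) = X2 s u (i, j) + X2 u t (i, j) + incr X s u i * incr X u t j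
  chen3 : ∀ (s u t : ℝ) (i j k : Fin d),
    X3 s t (i, j, k) = X3 s u (i, j, k) + X3 u t (i, j, k)
      + X2 s u (i, j) * incr X u t k + incr X s u i * X2 u t (j, k)
  holder_X : ∀ a b : ℝ, holderNorm γ (Set.Icc a b) (incr X) < ∞
  holder_X2 : ∀ a b : ℝ, holderNorm (2 * γ) (Set.Icc a b) X2 < ∞
  holder_X3 : ∀ a b : ℝ, holderNorm (3 * γ) (Set.Icc a b) X3 < ∞

namespace RoughPath

variable {d : ℕ} {γ : ℝ}

/-- The rough path is geometric: the symmetric parts of the second and the third level are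
the ones prescribed by the increments of the path. -/
def IsGeometric (𝕏 : RoughPath d γ) : Prop :=
  (∀ (s t : ℝ) (i j : Fin d),
    𝕏.X2 s t (i, j) + 𝕏.X2 s t (j, i) = incr 𝕏.X s t i * incr 𝕏.X s t j) ∧
  (∀ (s t : ℝ) (l : Fin 3 → Fin d),
    ∑ σ : Equiv.Perm (Fin 3), 𝕏.X3 s t (l (σ 0), l (σ 1), l (σ 2))
      = incr 𝕏.X s t (l 0) * incr 𝕏.X s t (l 1) * incr 𝕏.X s t (l 2))

/-- `‖𝕏‖_{γ, [a,b]}`, the maximum of `‖X‖_γ`, `‖X²‖_{2γ}^{1/2}` and `‖X³‖_{3γ}^{1/3}`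
(all three are finite). -/
noncomputable def norm (𝕏 : RoughPath d γ) (a b : ℝ) : ℝ :=
  max (holderNorm γ (Set.Icc a b) (incr 𝕏.X)).toReal
    (max (√(holderNorm (2 * γ) (Set.Icc a b) 𝕏.X2).toReal)
      ((holderNorm (3 * γ) (Set.Icc a b) 𝕏.X3).toReal ^ (1 / 3 : ℝ)))

end RoughPath

section Controlled

variable {d : ℕ} {γ : ℝ} {W : Type*} [NormedAddCommGroup W] [NormedSpace ℝ W]

/-- `A x` for `A ∈ L(ℝᵈ, L(ℝᵈ, W)) ≅ L(ℝᵈ ⊗ ℝᵈ, W)` and `x ∈ ℝᵈ ⊗ ℝᵈ`. -/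
noncomputable def act2 (A : Vec d →L[ℝ] Vec d →L[ℝ] W) (x : Tensor2 d) : W :=
  ∑ i, ∑ j, x (i, j) • A (e i) (e j)

/-- `A x` for `A ∈ L(ℝᵈ, L(ℝᵈ, L(ℝᵈ, W))) ≅ L(ℝᵈ ⊗ ℝᵈ ⊗ ℝᵈ, W)` and
`x ∈ ℝᵈ ⊗ ℝᵈ ⊗ ℝᵈ`. -/
noncomputable def act3 (A : Vec d →L[ℝ] Vec d →L[ℝ] Vec d →L[ℝ] W) (x : Tensor3 d) : W :=
  ∑ i, ∑ j, ∑ k, x (i, j, k) • A (e i) (e j) (e k)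

/-- The first-order remainder `δY_{s,t} - Y'_s δX_{s,t}`. It is used both for a path `Y` with
first Gubinelli derivative `Y'`, and for `Y⁽¹⁾` with derivative `Y⁽²⁾`, where it is the
remainder `(Y⁽¹⁾)^#`. -/
noncomputable def rem1 (𝕏 : RoughPath d γ) (Y : ℝ → W) (Y' : ℝ → Vec d →L[ℝ] W)
    (s t : ℝ) : W :=
  incr Y s t - Y' s (incr 𝕏.X s t)

/-- The second-order remainder `Y^#_{s,t} = δY_{s,t} - Y⁽¹⁾_s δX_{s,t} - Y⁽²⁾_s X²_{s,t}`. -/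
noncomputable def rem2 (𝕏 : RoughPath d γ) (Y : ℝ → W) (Y1 : ℝ → Vec d →L[ℝ] W)
    (Y2 : ℝ → Vec d →L[ℝ] Vec d →L[ℝ] W) (s t : ℝ) : W :=
  incr Y s t - Y1 s (incr 𝕏.X s t) - act2 (Y2 s) (𝕏.X2 s t)

/-- `(Y, Y⁽¹⁾, Y⁽²⁾)` is a path on `[a, b]` controlled by `𝕏`. For `γ ≤ 1/3` the order of the
remainder `Y^#` is `3γ`. For `γ > 1/3` it is `1`: a drift term `∫ V₀(Z) dt` is of order
`|t - s|` and no better, so that `3γ > 1` would exclude every equation with a drift. -/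
def IsControlled (𝕏 : RoughPath d γ) (a b : ℝ) (Y : ℝ → W) (Y1 : ℝ → Vec d →L[ℝ] W)
    (Y2 : ℝ → Vec d →L[ℝ] Vec d →L[ℝ] W) : Prop :=
  holderNorm γ (Set.Icc a b) (incr Y) < ∞ ∧
  holderNorm γ (Set.Icc a b) (incr Y1) < ∞ ∧
  holderNorm γ (Set.Icc a b) (incr Y2) < ∞ ∧
  holderNorm (2 * γ) (Set.Icc a b) (rem1 𝕏 Y1 Y2) < ∞ ∧
  holderNorm (min (3 * γ) 1) (Set.Icc a b) (rem2 𝕏 Y Y1 Y2) < ∞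

/-- The norm of the controlled path `(Y, Y⁽¹⁾, Y⁽²⁾)` on `[a, b]`; the order `min (3γ) 1` of
`Y^#` is `3γ` for `γ ≤ 1/3`. -/
noncomputable def controlledNorm (𝕏 : RoughPath d γ) (a b : ℝ) (Y : ℝ → W)
    (Y1 : ℝ → Vec d →L[ℝ] W) (Y2 : ℝ → Vec d →L[ℝ] Vec d →L[ℝ] W) : ℝ≥0∞ :=
  max (supNorm (Set.Icc a b) Y) <|
  max (supNorm (Set.Icc a b) Y1) <|
  max (supNorm (Set.Icc a b) Y2) <|
  max (holderNorm γ (Set.Icc a b) (incr Y2)) <|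
  max (holderNorm (2 * γ) (Set.Icc a b) (rem1 𝕏 Y1 Y2))
    (holderNorm (min (3 * γ) 1) (Set.Icc a b) (rem2 𝕏 Y Y1 Y2))

/-- The norm on `[a, b]` of a path `(Y, Y')` with one Gubinelli derivative, which is the usual
notion when `γ > 1/3`. -/
noncomputable def controlledNorm1 (𝕏 : RoughPath d γ) (a b : ℝ) (Y : ℝ → W)
    (Y' : ℝ → Vec d →L[ℝ] W) : ℝ≥0∞ :=
  max (supNorm (Set.Icc a b) Y) <|
  max (supNorm (Set.Icc a b) Y') <|
  max (holderNorm γ (Set.Icc a b) (incr Y'))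
    (holderNorm (2 * γ) (Set.Icc a b) (rem1 𝕏 Y Y'))

/-- `J` is the rough integral `∫_s^t Y d𝕏`: the limit, as the mesh of the partition
`s = τ₀ < τ₁ < ⋯ < τₙ = t` tends to zero, of the sums of
`Y_{τⱼ} δX_{τⱼ,τⱼ₊₁} + Y⁽¹⁾_{τⱼ} X²_{τⱼ,τⱼ₊₁} + Y⁽²⁾_{τⱼ} X³_{τⱼ,τⱼ₊₁}`. -/
def IsRoughIntegral (𝕏 : RoughPath d γ) (Y : ℝ → Vec d →L[ℝ] W)
    (Y1 : ℝ → Vec d →L[ℝ] Vec d →L[ℝ] W)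
    (Y2 : ℝ → Vec d →L[ℝ] Vec d →L[ℝ] Vec d →L[ℝ] W) (s t : ℝ) (J : W) : Prop :=
  ∀ ε > 0, ∃ δ > 0, ∀ (n : ℕ) (τ : ℕ → ℝ), τ 0 = s → τ n = t →
    (∀ j < n, τ j < τ (j + 1) ∧ τ (j + 1) - τ j < δ) →
    ‖(∑ j ∈ Finset.range n,
        (Y (τ j) (incr 𝕏.X (τ j) (τ (j + 1))) + act2 (Y1 (τ j)) (𝕏.X2 (τ j) (τ (j + 1)))
          + act3 (Y2 (τ j)) (𝕏.X3 (τ j) (τ (j + 1))))) - J‖ < ε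

end Controlled

section Equation

variable {d m : ℕ} {γ : ℝ}

/-- `V` is a `Lip^p` vector field: it is `⌊p⌋` times continuously differentiable, its
derivatives of the orders `1, …, ⌊p⌋` are bounded, and the last one is `(p - ⌊p⌋)`-Hölder
continuous on the whole space. -/
def IsLip (p : ℝ) (V : Vec m → Vec d →L[ℝ] Vec m) : Prop :=
  ContDiff ℝ ⌊p⌋₊ V ∧
  (∀ k : ℕ, 1 ≤ k → k ≤ ⌊p⌋₊ → ∃ C : ℝ, ∀ z, ‖iteratedFDeriv ℝ k V z‖ ≤ C) ∧
  (∃ C : ℝ, ∀ z₁ z₀ : Vec m, z₁ ≠ z₀ →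
    ‖iteratedFDeriv ℝ ⌊p⌋₊ V z₁ - iteratedFDeriv ℝ ⌊p⌋₊ V z₀‖ / ‖z₁ - z₀‖ ^ (p - ⌊p⌋₊) ≤ C)

/-- `v₁ ⊗ v₂ ↦ D_zV(V(z) v₁) v₂`. -/
noncomputable def DVV (V : Vec m → Vec d →L[ℝ] Vec m) (z : Vec m) :
    Vec d →L[ℝ] Vec d →L[ℝ] Vec m :=
  (fderiv ℝ V z).comp (V z)

/-- `v₁ ⊗ v₂ ⊗ v₃ ↦ D²_zV(V(z) v₁, V(z) v₂) v₃ + D_zV(D_zV(V(z) v₁) v₂) v₃`. -/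
noncomputable def DDVV (V : Vec m → Vec d →L[ℝ] Vec m) (z : Vec m) :
    Vec d →L[ℝ] Vec d →L[ℝ] Vec d →L[ℝ] Vec m :=
  (fderiv ℝ (fderiv ℝ V) z).bilinearComp (V z) (V z) +
    (ContinuousLinearMap.compL ℝ (Vec d) (Vec m) (Vec d →L[ℝ] Vec m) (fderiv ℝ V z)).comp
      (DVV V z)

theorem DDVV_apply (V : Vec m → Vec d →L[ℝ] Vec m) (z : Vec m) (v₁ v₂ v₃ : Vec d) :
    DDVV V z v₁ v₂ v₃ = fderiv ℝ (fderiv ℝ V) z (V z v₁) (V z v₂) v₃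
      + fderiv ℝ V z (fderiv ℝ V z (V z v₁) v₂) v₃ := rfl

/-- `Z` solves `dZ = V(Z) d𝕏 + V₀(Z) dt`, `Z₀ = z₀`, on `[0, ∞)`: the triple
`(Z, V(Z), D_ZV(V(Z)))` is controlled by `𝕏` on every interval `[0, T]`, and
`Z_t = z₀ + ∫_0^t V(Z) d𝕏 + ∫_0^t V₀(Z) dτ`, where the first integral is the rough integral of
`V(Z)` with its Gubinelli derivatives `D_ZV(V(Z))` and
`D²_ZV(V(Z), V(Z)) + D_ZV(D_ZV(V(Z)))`. -/
def IsSolution (𝕏 : RoughPath d γ) (V : Vec m → Vec d →L[ℝ] Vec m) (V₀ : Vec m → Vec m)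
    (z₀ : Vec m) (Z : ℝ → Vec m) : Prop :=
  (∀ T > 0, IsControlled 𝕏 0 T Z (fun t => V (Z t)) (fun t => DVV V (Z t))) ∧
  ∀ t ≥ 0, ∃ J : Vec m,
    IsRoughIntegral 𝕏 (fun τ => V (Z τ)) (fun τ => DVV V (Z τ)) (fun τ => DDVV V (Z τ)) 0 t J ∧
    Z t = z₀ + J + ∫ τ in (0 : ℝ)..t, V₀ (Z τ)

end Equation

end RoughDE

/-! The supremum and Hölder norms of the solution `Z` are controlled by hypothesis, so V(Z), DVV(Z)
and the increments of the latter follow from the bounds on the derivatives of V. The real content is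
a quantitative bound on the second-order remainder Z^#, with exponent ρ = min(3γ, 1). That Z^# has
finite ρ-Hölder norm is part of being a solution, but its size is not given.

All data on [0, T] are bounded by one constant A (`PathBounds`). If |Z^#_{a,b}| ≤ K (b - a)^ρ on
intervals of length at most ℓ ≤ 1, then Taylor expansion and Chen's relations bound the defect of
additivity of the compensated summands by (13 A^10 + 4 A^5 K)(b - a)^(ρ+γ) (`norm_summand_sub_le`).
Geometricity enters here: the second-order Taylor term of V sees only the symmetric part of X²,
which is δX ⊗ δX / 2. Since ρ + γ > 1, sewing along dyadic partitions compares the integral with its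
summand. The equation expresses Z^# as the sewing error, the X³ term and the drift, of which only
the first involves K. For 8 c A^5 ℓ^γ ≤ 1 this improves K to 5 A^10 + K/2 (`norm_rem2_le_of_le`).
Iterating from the unknown but finite initial K leaves 10 A^10 (`norm_rem2_le_of_short`).

The length ℓ is a negative power of A, so for |t - s| > ℓ the trivial bound on Z^# loses only a
power of A, and no patching of short intervals is needed (`norm_rem2_le`). The remaining entries of
the norms follow from Z^#. Everything is polynomial in A, and A is polynomial in a product of a
function of T and a polynomial in the initial value and the rough path norm (`exists_pathBounds`).
-/

namespace RoughDE

set_option maxSynthPendingDepth 3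

/-! ### Taylor estimates with uniform constants -/

section Taylor

variable {E G : Type*} [NormedAddCommGroup E] [NormedSpace ℝ E]
  [NormedAddCommGroup G] [NormedSpace ℝ G]

/-- Uniform bounds on the first two derivatives of `V` and on its Taylor remainders. -/
structure DerivBounds (V : E → G) (A : ℝ) : Prop where
  norm_fderiv_le : ∀ x, ‖fderiv ℝ V x‖ ≤ A
  norm_fderiv_fderiv_le : ∀ x, ‖fderiv ℝ (fderiv ℝ V) x‖ ≤ A
  norm_sub_le : ∀ x y, ‖V y - V x‖ ≤ A * ‖y - x‖
  norm_fderiv_sub_le : ∀ x y, ‖fderiv ℝ V y - fderiv ℝ V x‖ ≤ A * ‖y - x‖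
  norm_fderiv_fderiv_sub_le : ∀ x y,
    ‖fderiv ℝ (fderiv ℝ V) y - fderiv ℝ (fderiv ℝ V) x‖ ≤ A * ‖y - x‖
  taylor_one : ∀ x y, ‖V y - V x - fderiv ℝ V x (y - x)‖ ≤ A * ‖y - x‖ ^ 2
  taylor_one_fderiv : ∀ x y,
    ‖fderiv ℝ V y - fderiv ℝ V x - fderiv ℝ (fderiv ℝ V) x (y - x)‖ ≤ A * ‖y - x‖ ^ 2
  taylor_two : ∀ x y, ‖V y - V x - fderiv ℝ V x (y - x)
    - (1 / 2 : ℝ) • fderiv ℝ (fderiv ℝ V) x (y - x) (y - x)‖ ≤ A * ‖y - x‖ ^ 3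
  symm : ∀ x v w, fderiv ℝ (fderiv ℝ V) x v w = fderiv ℝ (fderiv ℝ V) x w v

theorem norm_sub_le_of_norm_fderiv_le {f : E → G} {A : ℝ} (hf : Differentiable ℝ f)
    (h : ∀ x, ‖fderiv ℝ f x‖ ≤ A) (x y : E) : ‖f y - f x‖ ≤ A * ‖y - x‖ :=
  convex_univ.norm_image_sub_le_of_norm_fderiv_le (fun z _ => hf z) (fun z _ => h z)
    (Set.mem_univ x) (Set.mem_univ y)

/-- Mean value inequality for f - Df(x) on the ball around x of radius |y - x|, where its derivative
is at most A |y - x|. The factor 1/2 is given up. -/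
theorem norm_taylor_one_le {f : E → G} {A : ℝ} (hf : Differentiable ℝ f) (hA : 0 ≤ A)
    (h : ∀ x y, ‖fderiv ℝ f y - fderiv ℝ f x‖ ≤ A * ‖y - x‖) (x y : E) :
    ‖f y - f x - fderiv ℝ f x (y - x)‖ ≤ A * ‖y - x‖ ^ 2 := by
  have h1 := (convex_closedBall x ‖y - x‖).norm_image_sub_le_of_norm_hasFDerivWithin_le'
    (f := f) (f' := fun z => fderiv ℝ f z) (φ := fderiv ℝ f x) (C := A * ‖y - x‖)
    (fun z _ => (hf z).hasFDerivAt.hasFDerivWithinAt)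
    (fun z hz => (h x z).trans (by
      gcongr
      simpa [dist_eq_norm] using hz))
    (Metric.mem_closedBall_self (norm_nonneg _))
    (show y ∈ Metric.closedBall x ‖y - x‖ by simp [dist_eq_norm])
  calc _ ≤ _ := h1
    _ = _ := by ring

/-- Subtracting half the quadratic form of D²f(x) from f leaves a map whose derivative at z differs
from Df(x) exactly by the first-order Taylor remainder of Df. The mean value inequality on a ball
then gains one power. -/
theorem norm_taylor_two_le {f : E → G} {A : ℝ} (hf : Differentiable ℝ f) (hA : 0 ≤ A)
    (x : E) (hs : ∀ v w, fderiv ℝ (fderiv ℝ f) x v w = fderiv ℝ (fderiv ℝ f) x w v)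
    (h : ∀ y, ‖fderiv ℝ f y - fderiv ℝ f x - fderiv ℝ (fderiv ℝ f) x (y - x)‖
      ≤ A * ‖y - x‖ ^ 2) (y : E) :
    ‖f y - f x - fderiv ℝ f x (y - x)
      - (1 / 2 : ℝ) • fderiv ℝ (fderiv ℝ f) x (y - x) (y - x)‖ ≤ A * ‖y - x‖ ^ 3 := by
  set L := fderiv ℝ (fderiv ℝ f) x with hL
  let g : E → G := fun z => f z - (1 / 2 : ℝ) • L (z - x) (z - x)
  have hg : ∀ z, HasFDerivAt g (fderiv ℝ f z - L (z - x)) z := by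
    intro z
    have h2 : HasFDerivAt (fun z => L (z - x)) L z := by
      have h0 := L.hasFDerivAt.comp z ((hasFDerivAt_id z).sub_const x)
      rwa [ContinuousLinearMap.comp_id] at h0
    have h3 := h2.clm_apply ((hasFDerivAt_id z).sub_const x)
    have h4 := (hf z).hasFDerivAt.sub (h3.const_smul (1 / 2 : ℝ))
    refine h4.congr_fderiv ?_
    ext v
    simp only [sub_apply, smul_apply,
      add_apply, ContinuousLinearMap.comp_apply,
      ContinuousLinearMap.flip_apply, ContinuousLinearMap.id_apply, id]
    -- Symmetry makes the two terms of the product rule equal, which cancels the factor 1/2.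
    rw [hs v (z - x), ← two_smul ℝ, smul_smul]
    norm_num
  have h1 := (convex_closedBall x ‖y - x‖).norm_image_sub_le_of_norm_hasFDerivWithin_le'
    (f := g) (f' := fun z => fderiv ℝ f z - L (z - x)) (φ := fderiv ℝ f x)
    (C := A * ‖y - x‖ ^ 2)
    (fun z _ => (hg z).hasFDerivWithinAt)
    (fun z hz => by
      have h5 := h z
      rw [sub_right_comm] at h5
      refine h5.trans ?_
      gcongr
      simpa [dist_eq_norm] using hz)
    (Metric.mem_closedBall_self (norm_nonneg _))
    (show y ∈ Metric.closedBall x ‖y - x‖ by simp [dist_eq_norm])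
  calc _ = ‖g y - g x - fderiv ℝ f x (y - x)‖ := by
        congr 1
        simp only [g, sub_self, map_zero, smul_zero, sub_zero]
        abel
    _ ≤ _ := h1
    _ = _ := by ring

theorem derivBounds_of_contDiff {V : E → G} {A : ℝ} (hV : ContDiff ℝ 3 V) (hA : 0 ≤ A)
    (h1 : ∀ x, ‖fderiv ℝ V x‖ ≤ A) (h2 : ∀ x, ‖fderiv ℝ (fderiv ℝ V) x‖ ≤ A)
    (h3 : ∀ x, ‖iteratedFDeriv ℝ 3 V x‖ ≤ A) : DerivBounds V A := by
  have c1 : ContDiff ℝ 2 (fderiv ℝ V) := hV.fderiv_right (by norm_num)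
  have c2 : ContDiff ℝ 1 (fderiv ℝ (fderiv ℝ V)) := c1.fderiv_right (by norm_num)
  have d0 := hV.differentiable (by norm_num)
  have d1 := c1.differentiable (by norm_num)
  have d2 := c2.differentiable (by norm_num)
  have hs : ∀ x v w, fderiv ℝ (fderiv ℝ V) x v w = fderiv ℝ (fderiv ℝ V) x w v := by
    intro x v w
    exact (hV.contDiffAt.isSymmSndFDerivAt (by simp; norm_num)).eq v w
  have l1 := norm_sub_le_of_norm_fderiv_le d1 h2
  have l2 := norm_sub_le_of_norm_fderiv_le d2 fun x => by
    rw [← norm_iteratedFDeriv_one, norm_iteratedFDeriv_fderiv, norm_iteratedFDeriv_fderiv]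
    exact h3 x
  have t1 := norm_taylor_one_le d1 hA l2
  exact
    { norm_fderiv_le := h1
      norm_fderiv_fderiv_le := h2
      norm_sub_le := norm_sub_le_of_norm_fderiv_le d0 h1
      norm_fderiv_sub_le := l1
      norm_fderiv_fderiv_sub_le := l2
      taylor_one := norm_taylor_one_le d0 hA l1
      taylor_one_fderiv := t1
      taylor_two := fun x y => norm_taylor_two_le d0 hA x (hs x) (t1 x) y
      symm := hs }

end Taylor

/-- Derivatives up to order three are bounded because ⌊p⌋ ≥ 3. Every larger constant is admitted as
well, so that V can later share one constant with the path and the rough path. -/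
theorem IsLip.exists_derivBounds {d m : ℕ} {p : ℝ} (hp : 3 ≤ p)
    {V : Vec m → Vec d →L[ℝ] Vec m} (hV : IsLip p V) :
    ∃ C : ℝ, ∀ A ≥ C, DerivBounds V A := by
  have h3 : 3 ≤ ⌊p⌋₊ := Nat.le_floor (by exact_mod_cast hp)
  obtain ⟨hV, hb, -⟩ := hV
  obtain ⟨C1, h1⟩ := hb 1 le_rfl (by omega)
  obtain ⟨C2, h2⟩ := hb 2 (by norm_num) (by omega)
  obtain ⟨C3, h3'⟩ := hb 3 (by norm_num) h3
  refine ⟨max 0 (max C1 (max C2 C3)), fun A hA => ?_⟩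
  simp only [ge_iff_le, max_le_iff] at hA
  obtain ⟨a0, a1, a2, a3⟩ := hA
  refine derivBounds_of_contDiff (hV.of_le (by exact_mod_cast h3)) a0 (fun x => ?_)
    (fun x => ?_) (fun x => (h3' x).trans a3)
  · rw [← norm_iteratedFDeriv_one (𝕜 := ℝ)]
    exact (h1 x).trans a1
  · rw [← norm_iteratedFDeriv_one, norm_iteratedFDeriv_fderiv]
    exact (h2 x).trans a2

/-! ### Contractions with tensors and Chen's relations -/

section Tensors

variable {d : ℕ} {W W' : Type*} [NormedAddCommGroup W] [NormedSpace ℝ W]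
  [NormedAddCommGroup W'] [NormedSpace ℝ W']

theorem norm_e (i : Fin d) : ‖(e i : Vec d)‖ = 1 := by simp [e]

theorem sum_smul_e (x : Vec d) : ∑ i, x i • (e i : Vec d) = x := by
  simpa [e] using (EuclideanSpace.basisFun (Fin d) ℝ).sum_repr x

theorem map_eq_sum (L : Vec d →L[ℝ] W) (x : Vec d) : L x = ∑ i, x i • L (e i) := by
  conv_lhs => rw [← sum_smul_e x]
  simp

theorem norm_act2_le (A : Vec d →L[ℝ] Vec d →L[ℝ] W) (x : Tensor2 d) :
    ‖act2 A x‖ ≤ (d : ℝ) ^ 2 * (‖A‖ * ‖x‖) := by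
  have h : ∀ i j, ‖x (i, j) • A (e i) (e j)‖ ≤ ‖A‖ * ‖x‖ := fun i j => by
    rw [norm_smul, mul_comm]
    gcongr
    · simpa [norm_e] using A.le_opNorm₂ (e i) (e j)
    · exact PiLp.norm_apply_le x (i, j)
  calc ‖act2 A x‖ ≤ ∑ _i : Fin d, ∑ _j : Fin d, ‖A‖ * ‖x‖ :=
        (norm_sum_le _ _).trans (Finset.sum_le_sum fun i _ =>
          (norm_sum_le _ _).trans (Finset.sum_le_sum fun j _ => h i j))
    _ = _ := by simp; ring

theorem norm_act3_le (A : Vec d →L[ℝ] Vec d →L[ℝ] Vec d →L[ℝ] W) (x : Tensor3 d) :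
    ‖act3 A x‖ ≤ (d : ℝ) ^ 3 * (‖A‖ * ‖x‖) := by
  have h : ∀ i j k, ‖x (i, j, k) • A (e i) (e j) (e k)‖ ≤ ‖A‖ * ‖x‖ := fun i j k => by
    rw [norm_smul, mul_comm]
    gcongr
    · calc ‖A (e i) (e j) (e k)‖ ≤ ‖A (e i)‖ * ‖(e j : Vec d)‖ * ‖(e k : Vec d)‖ :=
            (A (e i)).le_opNorm₂ _ _
        _ ≤ ‖A‖ := by simpa [norm_e] using A.le_opNorm (e i)
    · exact PiLp.norm_apply_le x (i, j, k)
  calc ‖act3 A x‖ ≤ ∑ _i : Fin d, ∑ _j : Fin d, ∑ _k : Fin d, ‖A‖ * ‖x‖ :=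
        (norm_sum_le _ _).trans (Finset.sum_le_sum fun i _ =>
          (norm_sum_le _ _).trans (Finset.sum_le_sum fun j _ =>
            (norm_sum_le _ _).trans (Finset.sum_le_sum fun k _ => h i j k)))
    _ = _ := by simp; ring

theorem act2_sub_left (A B : Vec d →L[ℝ] Vec d →L[ℝ] W) (x : Tensor2 d) :
    act2 (A - B) x = act2 A x - act2 B x := by
  simp [act2, smul_sub]

theorem act2_apply (A : Vec d →L[ℝ] Vec d →L[ℝ] Vec d →L[ℝ] W) (x : Tensor2 d) (v : Vec d) :
    act2 A x v = ∑ i, ∑ j, x (i, j) • A (e i) (e j) v := by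
  simp [act2]

theorem act3_sub_left (A B : Vec d →L[ℝ] Vec d →L[ℝ] Vec d →L[ℝ] W) (x : Tensor3 d) :
    act3 (A - B) x = act3 A x - act3 B x := by
  simp [act3, smul_sub]

theorem map_map_eq_sum (A : Vec d →L[ℝ] Vec d →L[ℝ] W) (v w : Vec d) :
    A v w = ∑ i, ∑ j, (v i * w j) • A (e i) (e j) := by
  rw [map_eq_sum A v, sum_apply]
  refine Finset.sum_congr rfl fun i _ => ?_
  rw [smul_apply, map_eq_sum (A (e i)) w, Finset.smul_sum]
  simp [smul_smul]

/-- Against a symmetric bilinear map only the symmetric part of a tensor counts. -/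
theorem act2_of_symm {A : Vec d →L[ℝ] Vec d →L[ℝ] W} (hA : ∀ v w, A v w = A w v)
    {x : Tensor2 d} {ξ : Vec d} (hx : ∀ i j, x (i, j) + x (j, i) = ξ i * ξ j) :
    act2 A x = (1 / 2 : ℝ) • A ξ ξ := by
  have h : act2 A x + act2 A x = A ξ ξ := by
    conv_lhs => rhs; rw [act2, Finset.sum_comm]
    rw [map_map_eq_sum, act2, ← Finset.sum_add_distrib]
    refine Finset.sum_congr rfl fun i _ => ?_
    rw [← Finset.sum_add_distrib]
    refine Finset.sum_congr rfl fun j _ => ?_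
    rw [← hx i j, hA (e j) (e i), add_smul]
  rw [← h, ← two_smul ℝ, smul_smul]
  norm_num

/-- Handles the summand DV(DV(V)) of `DDVV`: its contraction with X² is DV applied to the
contraction of `DVV`. -/
theorem act2_comp_left (L : W →L[ℝ] W') (A : Vec d →L[ℝ] Vec d →L[ℝ] W) (x : Tensor2 d) :
    L (act2 A x) = act2 ((ContinuousLinearMap.compL ℝ (Vec d) W W' L).comp A) x := by
  simp [act2, map_sum]

variable {γ : ℝ} (𝕏 : RoughPath d γ)

theorem incr_add {V : Type*} [NormedAddCommGroup V] (ξ : ℝ → V) (s u t : ℝ) :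
    incr ξ s t = incr ξ s u + incr ξ u t := by simp [incr]

theorem act2_chen (A : Vec d →L[ℝ] Vec d →L[ℝ] W) (s u t : ℝ) :
    act2 A (𝕏.X2 s t) = act2 A (𝕏.X2 s u) + act2 A (𝕏.X2 u t)
      + A (incr 𝕏.X s u) (incr 𝕏.X u t) := by
  rw [map_map_eq_sum A]
  simp only [act2, ← Finset.sum_add_distrib]
  refine Finset.sum_congr rfl fun i _ => Finset.sum_congr rfl fun j _ => ?_
  rw [𝕏.chen2 s u t i j, add_smul, add_smul]

theorem act3_chen (A : Vec d →L[ℝ] Vec d →L[ℝ] Vec d →L[ℝ] W) (s u t : ℝ) :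
    act3 A (𝕏.X3 s t) = act3 A (𝕏.X3 s u) + act3 A (𝕏.X3 u t)
      + act2 A (𝕏.X2 s u) (incr 𝕏.X u t) + act2 (A (incr 𝕏.X s u)) (𝕏.X2 u t) := by
  have h1 : act2 A (𝕏.X2 s u) (incr 𝕏.X u t) = ∑ i, ∑ j, ∑ k,
      (𝕏.X2 s u (i, j) * incr 𝕏.X u t k) • A (e i) (e j) (e k) := by
    rw [act2_apply]
    refine Finset.sum_congr rfl fun i _ => Finset.sum_congr rfl fun j _ => ?_
    rw [map_eq_sum (A (e i) (e j)), Finset.smul_sum]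
    simp only [smul_smul]
  have h2 : act2 (A (incr 𝕏.X s u)) (𝕏.X2 u t) = ∑ i, ∑ j, ∑ k,
      (incr 𝕏.X s u i * 𝕏.X2 u t (j, k)) • A (e i) (e j) (e k) := by
    rw [map_eq_sum A (incr 𝕏.X s u), act2]
    simp only [sum_apply, smul_apply, Finset.smul_sum, smul_smul]
    rw [Finset.sum_congr rfl fun j _ => Finset.sum_comm, Finset.sum_comm]
    refine Finset.sum_congr rfl fun i _ => Finset.sum_congr rfl fun j _ =>
      Finset.sum_congr rfl fun k _ => ?_
    rw [mul_comm]
  rw [h1, h2]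
  simp only [act3, ← Finset.sum_add_distrib]
  refine Finset.sum_congr rfl fun i _ => Finset.sum_congr rfl fun j _ =>
    Finset.sum_congr rfl fun k _ => ?_
  rw [𝕏.chen3 s u t i j k, add_smul, add_smul, add_smul]

/-- The compensated Riemann summand of the rough integral. -/
noncomputable def summand (𝕏 : RoughPath d γ) (Y : ℝ → Vec d →L[ℝ] W)
    (Y1 : ℝ → Vec d →L[ℝ] Vec d →L[ℝ] W)
    (Y2 : ℝ → Vec d →L[ℝ] Vec d →L[ℝ] Vec d →L[ℝ] W) (s t : ℝ) : W :=
  Y s (incr 𝕏.X s t) + act2 (Y1 s) (𝕏.X2 s t) + act3 (Y2 s) (𝕏.X3 s t)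

/-- The defect of additivity of the compensated Riemann summands of a rough integral. -/
theorem summand_sub_summand (Y : ℝ → Vec d →L[ℝ] W) (Y1 : ℝ → Vec d →L[ℝ] Vec d →L[ℝ] W)
    (Y2 : ℝ → Vec d →L[ℝ] Vec d →L[ℝ] Vec d →L[ℝ] W) (s u t : ℝ) :
    summand 𝕏 Y Y1 Y2 s t - summand 𝕏 Y Y1 Y2 s u - summand 𝕏 Y Y1 Y2 u t
    = -(rem2 𝕏 Y Y1 Y2 s u (incr 𝕏.X u t) + act2 (rem1 𝕏 Y1 Y2 s u) (𝕏.X2 u t)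
      + act3 (incr Y2 s u) (𝕏.X3 u t)) := by
  unfold summand
  rw [act2_chen 𝕏 (Y1 s) s u t, act3_chen 𝕏 (Y2 s) s u t, incr_add 𝕏.X s u t]
  simp only [rem2, rem1, incr, act2_sub_left, act3_sub_left, sub_apply, map_add]
  abel

end Tensors

/-! ### Remainders of V, DVV and DDVV over a single increment -/

section Pointwise

variable {d m : ℕ} {V : Vec m → Vec d →L[ℝ] Vec m} {A : ℝ}

theorem norm_act2_le_of_le {W : Type*} [NormedAddCommGroup W] [NormedSpace ℝ W]
    (hd : (d : ℝ) ^ 2 ≤ A) {L : Vec d →L[ℝ] Vec d →L[ℝ] W} {x : Tensor2 d} {b c : ℝ}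
    (hL : ‖L‖ ≤ b) (hx : ‖x‖ ≤ c) : ‖act2 L x‖ ≤ A * (b * c) := by
  refine (norm_act2_le L x).trans ?_
  have : 0 ≤ b := (norm_nonneg _).trans hL
  have : 0 ≤ A := le_trans (by positivity) hd
  gcongr

theorem norm_act3_le_of_le {W : Type*} [NormedAddCommGroup W] [NormedSpace ℝ W]
    (hd : (d : ℝ) ^ 3 ≤ A) {L : Vec d →L[ℝ] Vec d →L[ℝ] Vec d →L[ℝ] W} {x : Tensor3 d}
    {b c : ℝ} (hL : ‖L‖ ≤ b) (hx : ‖x‖ ≤ c) : ‖act3 L x‖ ≤ A * (b * c) := by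
  refine (norm_act3_le L x).trans ?_
  have : 0 ≤ b := (norm_nonneg _).trans hL
  have : 0 ≤ A := le_trans (by positivity) hd
  gcongr

theorem norm_DVV_le (hD : DerivBounds V A) {x : Vec m} (hx : ‖V x‖ ≤ A) :
    ‖DVV V x‖ ≤ A ^ 2 := by
  have h := hD.norm_fderiv_le x
  have : 0 ≤ A := (norm_nonneg _).trans hx
  calc ‖DVV V x‖ ≤ ‖fderiv ℝ V x‖ * ‖V x‖ := ContinuousLinearMap.opNorm_comp_le _ _
    _ ≤ A * A := by gcongr
    _ = A ^ 2 := by ring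

theorem norm_DVV_sub_le (hD : DerivBounds V A) {x y : Vec m} (hy : ‖V y‖ ≤ A) :
    ‖DVV V y - DVV V x‖ ≤ 2 * A ^ 2 * ‖y - x‖ := by
  have hA : 0 ≤ A := (norm_nonneg _).trans hy
  have h : DVV V y - DVV V x
      = (fderiv ℝ V y - fderiv ℝ V x).comp (V y) + (fderiv ℝ V x).comp (V y - V x) := by
    ext; simp [DVV]
  have h1 := hD.norm_fderiv_sub_le x y
  have h2 := hD.norm_sub_le x y
  have h3 := hD.norm_fderiv_le x
  calc _ ≤ ‖fderiv ℝ V y - fderiv ℝ V x‖ * ‖V y‖ + ‖fderiv ℝ V x‖ * ‖V y - V x‖ := by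
        rw [h]
        exact norm_add_le_of_le (ContinuousLinearMap.opNorm_comp_le _ _)
          (ContinuousLinearMap.opNorm_comp_le _ _)
    _ ≤ (A * ‖y - x‖) * A + A * (A * ‖y - x‖) := by gcongr
    _ = _ := by ring

theorem norm_bilinearComp_le {E F G E' : Type*} [NormedAddCommGroup E] [NormedSpace ℝ E]
    [NormedAddCommGroup F] [NormedSpace ℝ F] [NormedAddCommGroup G] [NormedSpace ℝ G]
    [NormedAddCommGroup E'] [NormedSpace ℝ E'] (B : E →L[ℝ] E →L[ℝ] G) (f : F →L[ℝ] E)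
    (g : E' →L[ℝ] E) : ‖B.bilinearComp f g‖ ≤ ‖B‖ * ‖f‖ * ‖g‖ := by
  refine ContinuousLinearMap.opNorm_le_bound₂ _ (by positivity) fun v w => ?_
  calc ‖B (f v) (g w)‖ ≤ ‖B‖ * ‖f v‖ * ‖g w‖ := B.le_opNorm₂ _ _
    _ ≤ ‖B‖ * (‖f‖ * ‖v‖) * (‖g‖ * ‖w‖) := by
        gcongr
        · exact f.le_opNorm v
        · exact g.le_opNorm w
    _ = _ := by ring

theorem norm_compL_comp_le {F G G' E' : Type*} [NormedAddCommGroup F] [NormedSpace ℝ F]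
    [NormedAddCommGroup G] [NormedSpace ℝ G] [NormedAddCommGroup G'] [NormedSpace ℝ G']
    [NormedAddCommGroup E'] [NormedSpace ℝ E'] (L : G →L[ℝ] G') (f : F →L[ℝ] E' →L[ℝ] G) :
    ‖(ContinuousLinearMap.compL ℝ E' G G' L).comp f‖ ≤ ‖L‖ * ‖f‖ := by
  refine ContinuousLinearMap.opNorm_le_bound₂ _ (by positivity) fun v w => ?_
  calc ‖L (f v w)‖ ≤ ‖L‖ * ‖f v w‖ := L.le_opNorm _
    _ ≤ ‖L‖ * (‖f‖ * ‖v‖ * ‖w‖) := by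
        gcongr
        exact f.le_opNorm₂ _ _
    _ = _ := by ring

theorem norm_DDVV_le (hD : DerivBounds V A) {x : Vec m} (hx : ‖V x‖ ≤ A) :
    ‖DDVV V x‖ ≤ 2 * A ^ 3 := by
  have hA : 0 ≤ A := (norm_nonneg _).trans hx
  have h1 := hD.norm_fderiv_le x
  have h2 := hD.norm_fderiv_fderiv_le x
  have h3 := norm_DVV_le hD hx
  calc _ ≤ ‖fderiv ℝ (fderiv ℝ V) x‖ * ‖V x‖ * ‖V x‖ + ‖fderiv ℝ V x‖ * ‖DVV V x‖ :=
        norm_add_le_of_le (norm_bilinearComp_le _ _ _) (norm_compL_comp_le _ _)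
    _ ≤ A * A * A + A * A ^ 2 := by gcongr
    _ = _ := by ring

theorem norm_bilinearComp_sub_le {E F G : Type*} [NormedAddCommGroup E] [NormedSpace ℝ E]
    [NormedAddCommGroup F] [NormedSpace ℝ F] [NormedAddCommGroup G] [NormedSpace ℝ G]
    (B B' : E →L[ℝ] E →L[ℝ] G) (f f' : F →L[ℝ] E) :
    ‖B'.bilinearComp f' f' - B.bilinearComp f f‖
      ≤ ‖B' - B‖ * ‖f'‖ * ‖f'‖ + ‖B‖ * ‖f' - f‖ * ‖f'‖ + ‖B‖ * ‖f‖ * ‖f' - f‖ := by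
  have h : B'.bilinearComp f' f' - B.bilinearComp f f = (B' - B).bilinearComp f' f'
      + B.bilinearComp (f' - f) f' + B.bilinearComp f (f' - f) := by
    refine ContinuousLinearMap.ext fun v => ContinuousLinearMap.ext fun w => ?_
    simp
  rw [h]
  exact norm_add_le_of_le (norm_add_le_of_le (norm_bilinearComp_le _ _ _)
    (norm_bilinearComp_le _ _ _)) (norm_bilinearComp_le _ _ _)

theorem norm_compL_comp_sub_le {F G G' E' : Type*} [NormedAddCommGroup F] [NormedSpace ℝ F]
    [NormedAddCommGroup G] [NormedSpace ℝ G] [NormedAddCommGroup G'] [NormedSpace ℝ G']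
    [NormedAddCommGroup E'] [NormedSpace ℝ E'] (L L' : G →L[ℝ] G')
    (f f' : F →L[ℝ] E' →L[ℝ] G) :
    ‖(ContinuousLinearMap.compL ℝ E' G G' L').comp f'
      - (ContinuousLinearMap.compL ℝ E' G G' L).comp f‖
      ≤ ‖L' - L‖ * ‖f'‖ + ‖L‖ * ‖f' - f‖ := by
  have h : (ContinuousLinearMap.compL ℝ E' G G' L').comp f'
      - (ContinuousLinearMap.compL ℝ E' G G' L).comp f
      = (ContinuousLinearMap.compL ℝ E' G G' (L' - L)).comp f'
        + (ContinuousLinearMap.compL ℝ E' G G' L).comp (f' - f) := by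
    refine ContinuousLinearMap.ext fun v => ContinuousLinearMap.ext fun w => ?_
    simp
  rw [h]
  exact norm_add_le_of_le (norm_compL_comp_le _ _) (norm_compL_comp_le _ _)

theorem norm_DDVV_sub_le (hD : DerivBounds V A) {x y : Vec m} (hx : ‖V x‖ ≤ A)
    (hy : ‖V y‖ ≤ A) : ‖DDVV V y - DDVV V x‖ ≤ 6 * A ^ 3 * ‖y - x‖ := by
  have hA : 0 ≤ A := (norm_nonneg _).trans hy
  have h1 := hD.norm_fderiv_le x
  have h2 := hD.norm_fderiv_fderiv_le x
  have h3 := norm_DVV_sub_le hD (x := x) hy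
  have h4 := norm_DVV_le hD hy
  have h5 := hD.norm_sub_le x y
  have h6 := hD.norm_fderiv_sub_le x y
  have h7 := hD.norm_fderiv_fderiv_sub_le x y
  have hB := norm_bilinearComp_sub_le (fderiv ℝ (fderiv ℝ V) x) (fderiv ℝ (fderiv ℝ V) y)
    (V x) (V y)
  have hL := norm_compL_comp_sub_le (fderiv ℝ V x) (fderiv ℝ V y) (DVV V x) (DVV V y)
  rw [DDVV, DDVV, add_sub_add_comm]
  calc _ ≤ _ := norm_add_le_of_le hB hL
    _ ≤ ((A * ‖y - x‖) * A * A + A * (A * ‖y - x‖) * A + A * A * (A * ‖y - x‖))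
        + ((A * ‖y - x‖) * A ^ 2 + A * (2 * A ^ 2 * ‖y - x‖)) := by gcongr
    _ = _ := by ring

/-- The Taylor remainder of first order of `z ↦ D_zV(V(z))`. -/
theorem norm_DVV_taylor_le (hD : DerivBounds V A) {x y : Vec m} (hy : ‖V y‖ ≤ A) :
    ‖DVV V y - DVV V x - ((fderiv ℝ (fderiv ℝ V) x (y - x)).comp (V x)
      + (fderiv ℝ V x).comp (fderiv ℝ V x (y - x)))‖ ≤ 3 * A ^ 2 * ‖y - x‖ ^ 2 := by
  have hA : 0 ≤ A := (norm_nonneg _).trans hy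
  have h1 := hD.norm_fderiv_le x
  have h2 := hD.norm_fderiv_fderiv_le x
  have h3 := hD.norm_sub_le x y
  have h4 := hD.taylor_one x y
  have h5 := hD.taylor_one_fderiv x y
  set B := fderiv ℝ (fderiv ℝ V)
  set L := fderiv ℝ V
  have h6 : ‖B x (y - x)‖ ≤ A * ‖y - x‖ := (B x).le_of_opNorm_le h2 _
  have h : DVV V y - DVV V x - ((B x (y - x)).comp (V x) + (L x).comp (L x (y - x)))
      = (L y - L x - B x (y - x)).comp (V y) + (B x (y - x)).comp (V y - V x)
        + (L x).comp (V y - V x - L x (y - x)) := by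
    ext1 v
    ext1 w
    simp only [DVV, add_apply, sub_apply, ContinuousLinearMap.comp_apply, map_sub, L]
    abel
  calc _ ≤ ‖L y - L x - B x (y - x)‖ * ‖V y‖ + ‖B x (y - x)‖ * ‖V y - V x‖
        + ‖L x‖ * ‖V y - V x - L x (y - x)‖ := by
        rw [h]
        exact norm_add_le_of_le (norm_add_le_of_le (ContinuousLinearMap.opNorm_comp_le _ _)
          (ContinuousLinearMap.opNorm_comp_le _ _)) (ContinuousLinearMap.opNorm_comp_le _ _)
    _ ≤ (A * ‖y - x‖ ^ 2) * A + (A * ‖y - x‖) * (A * ‖y - x‖) + A * (A * ‖y - x‖ ^ 2) := by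
        gcongr
    _ = _ := by ring

variable {x y : Vec m} {ξ : Vec d} {x2 : Tensor2 d} {a ε : ℝ}

/-- Here and below x, y stand for Z at two times, ξ and x2 for the increments of the rough path, a
for |t - s|^γ and ε for the bound on Z^#. The first-order remainder is Z^# plus the X² term. -/
theorem norm_first_remainder_le (hd : (d : ℝ) ^ 2 ≤ A) (hD : DerivBounds V A)
    (hx : ‖V x‖ ≤ A) (hx2 : ‖x2‖ ≤ A ^ 2 * a ^ 2)
    (he : ‖y - x - V x ξ - act2 (DVV V x) x2‖ ≤ ε) :
    ‖y - x - V x ξ‖ ≤ A ^ 5 * a ^ 2 + ε := by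
  have h := norm_act2_le_of_le hd (norm_DVV_le hD hx) hx2
  calc _ = ‖act2 (DVV V x) x2 + (y - x - V x ξ - act2 (DVV V x) x2)‖ := by congr 1; abel
    _ ≤ A * (A ^ 2 * (A ^ 2 * a ^ 2)) + ε := norm_add_le_of_le h he
    _ = _ := by ring

theorem norm_rem1_V_le (hA : 1 ≤ A) (hd : (d : ℝ) ^ 2 ≤ A) (hD : DerivBounds V A)
    (hx : ‖V x‖ ≤ A) (hw : ‖y - x‖ ≤ A * a) (hx2 : ‖x2‖ ≤ A ^ 2 * a ^ 2)
    (he : ‖y - x - V x ξ - act2 (DVV V x) x2‖ ≤ ε) :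
    ‖V y - V x - DVV V x ξ‖ ≤ 2 * A ^ 6 * a ^ 2 + A * ε := by
  have hr := norm_first_remainder_le hd hD hx hx2 he
  have h1 := hD.taylor_one x y
  calc _ = ‖(V y - V x - fderiv ℝ V x (y - x)) + fderiv ℝ V x (y - x - V x ξ)‖ := by
        congr 1
        rw [map_sub _ (y - x)]
        simp only [DVV, ContinuousLinearMap.comp_apply]
        abel
    _ ≤ A * (A * a) ^ 2 + A * (A ^ 5 * a ^ 2 + ε) := by
        refine norm_add_le_of_le (h1.trans (by gcongr)) ?_
        exact (ContinuousLinearMap.le_of_opNorm_le _ (hD.norm_fderiv_le x) _).trans (by gcongr)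
    _ = A ^ 3 * a ^ 2 + A ^ 6 * a ^ 2 + A * ε := by ring
    _ ≤ A ^ 6 * a ^ 2 + A ^ 6 * a ^ 2 + A * ε := by
        gcongr
        all_goals norm_num
    _ = _ := by ring

/-- `DDVV` is the derivative of `DVV` in the direction V(x)ξ, so the error is a Taylor remainder
plus that derivative evaluated at the first-order remainder of Z. -/
theorem norm_rem1_DVV_le (hA : 1 ≤ A) (hd : (d : ℝ) ^ 2 ≤ A) (hD : DerivBounds V A)
    (hx : ‖V x‖ ≤ A) (hy : ‖V y‖ ≤ A) (hw : ‖y - x‖ ≤ A * a) (hx2 : ‖x2‖ ≤ A ^ 2 * a ^ 2)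
    (he : ‖y - x - V x ξ - act2 (DVV V x) x2‖ ≤ ε) :
    ‖DVV V y - DVV V x - DDVV V x ξ‖ ≤ 5 * A ^ 7 * a ^ 2 + 2 * A ^ 2 * ε := by
  have hr := norm_first_remainder_le hd hD hx hx2 he
  have h1 := norm_DVV_taylor_le hD (x := x) hy
  set B := fderiv ℝ (fderiv ℝ V)
  set L := fderiv ℝ V
  set r := y - x - V x ξ with hrdef
  have h2 : DDVV V x ξ = (B x (V x ξ)).comp (V x) + (L x).comp (L x (V x ξ)) := rfl
  have hb : ‖B x r‖ ≤ A * ‖r‖ := (B x).le_of_opNorm_le (hD.norm_fderiv_fderiv_le x) _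
  have hl : ‖L x r‖ ≤ A * ‖r‖ := (L x).le_of_opNorm_le (hD.norm_fderiv_le x) _
  have hl' := hD.norm_fderiv_le x
  calc _ = ‖(DVV V y - DVV V x - ((B x (y - x)).comp (V x) + (L x).comp (L x (y - x))))
        + ((B x r).comp (V x) + (L x).comp (L x r))‖ := by
        congr 1
        rw [h2, hrdef, map_sub (B x) (y - x), map_sub (L x) (y - x),
          ContinuousLinearMap.sub_comp, ContinuousLinearMap.comp_sub]
        abel
    _ ≤ 3 * A ^ 2 * (A * a) ^ 2 + ((A * (A ^ 5 * a ^ 2 + ε)) * A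
        + A * (A * (A ^ 5 * a ^ 2 + ε))) := by
        refine norm_add_le_of_le (h1.trans (by gcongr)) (norm_add_le_of_le ?_ ?_)
        · exact (ContinuousLinearMap.opNorm_comp_le _ _).trans
            (mul_le_mul (hb.trans (by gcongr)) hx (norm_nonneg _)
              (((norm_nonneg _).trans hb).trans (by gcongr)))
        · exact (ContinuousLinearMap.opNorm_comp_le _ _).trans
            (mul_le_mul hl' (hl.trans (by gcongr)) (norm_nonneg _) (by positivity))
    _ = 3 * A ^ 4 * a ^ 2 + 2 * A ^ 7 * a ^ 2 + 2 * A ^ 2 * ε := by ring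
    _ ≤ 3 * A ^ 7 * a ^ 2 + 2 * A ^ 7 * a ^ 2 + 2 * A ^ 2 * ε := by
        gcongr
        all_goals norm_num
    _ = _ := by ring

/-- The second-order remainder of `V(Z)`. The symmetric part of `x2` is prescribed by `ξ`. -/
theorem norm_rem2_V_le (hA : 1 ≤ A) (hd : (d : ℝ) ^ 2 ≤ A) (hD : DerivBounds V A)
    (hx : ‖V x‖ ≤ A) (ha : 0 ≤ a) (hw : ‖y - x‖ ≤ A * a) (hξ : ‖ξ‖ ≤ A * a)
    (hx2 : ‖x2‖ ≤ A ^ 2 * a ^ 2) (hsymm : ∀ i j, x2 (i, j) + x2 (j, i) = ξ i * ξ j)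
    (he : ‖y - x - V x ξ - act2 (DVV V x) x2‖ ≤ ε) :
    ‖V y - V x - DVV V x ξ - act2 (DDVV V x) x2‖
      ≤ A ^ 4 * a ^ 3 + A * ε + A ^ 3 * a * (A ^ 5 * a ^ 2 + ε) := by
  have hr := norm_first_remainder_le hd hD hx hx2 he
  have h1 := hD.taylor_two x y
  set B := fderiv ℝ (fderiv ℝ V) with hB
  set L := fderiv ℝ V with hL
  set r := y - x - V x ξ with hrdef
  set w := y - x with hwdef
  set ζ := r - act2 (DVV V x) x2 with hζ
  -- The D²V summand is a symmetric bilinear form in the first two slots, so geometricity turns its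
  -- contraction into half its value at (ξ, ξ).
  have hact : act2 (DDVV V x) x2
      = (1 / 2 : ℝ) • B x (V x ξ) (V x ξ) + L x (act2 (DVV V x) x2) := by
    have h := act2_of_symm (A := (B x).bilinearComp (V x) (V x))
      (fun v w => hD.symm x _ _) hsymm
    rw [ContinuousLinearMap.bilinearComp_apply] at h
    rw [act2_comp_left, ← h]
    simp only [act2, ← Finset.sum_add_distrib, ← smul_add]
    rfl
  have hb := hD.norm_fderiv_fderiv_le x
  have hVξ : ‖V x ξ‖ ≤ A * (A * a) := (ContinuousLinearMap.le_of_opNorm_le _ hx _).trans (by gcongr)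
  have hr0 : 0 ≤ A ^ 5 * a ^ 2 + ε := (norm_nonneg _).trans hr
  -- Second-order Taylor remainder, DV applied to Z^#, and the error of replacing w by V(x)ξ in the
  -- quadratic term. The last is linear in the first-order remainder r.
  calc _ = ‖(V y - V x - L x w - (1 / 2 : ℝ) • B x w w) + L x ζ
        + (1 / 2 : ℝ) • (B x w r + B x r (V x ξ))‖ := by
        have e1 : L x ζ = L x w - L x (V x ξ) - L x (act2 (DVV V x) x2) := by
          rw [hζ, hrdef, map_sub (L x), map_sub (L x) w]
        have e2 : B x w r = B x w w - B x w (V x ξ) := by rw [hrdef, map_sub]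
        have e3 : B x r (V x ξ) = B x w (V x ξ) - B x (V x ξ) (V x ξ) := by
          rw [hrdef, map_sub (B x) w, sub_apply]
        have e4 : DVV V x ξ = L x (V x ξ) := rfl
        rw [hact, e1, e2, e3, e4, smul_add, smul_sub, smul_sub]
        congr 1
        abel
    _ ≤ A * (A * a) ^ 3 + A * ε + 1 / 2 * (A * (A * a) * (A ^ 5 * a ^ 2 + ε)
        + A * (A ^ 5 * a ^ 2 + ε) * (A * (A * a))) := by
        refine norm_add_le_of_le (norm_add_le_of_le (h1.trans (by gcongr)) ?_) ?_
        · exact (ContinuousLinearMap.le_of_opNorm_le _ (hD.norm_fderiv_le x) _).trans (by gcongr)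
        · rw [norm_smul]
          norm_num only [Real.norm_eq_abs, abs_of_pos]
          gcongr
          refine norm_add_le_of_le ?_ ?_
          · exact ((B x).le_opNorm₂ _ _).trans (by gcongr)
          · exact ((B x).le_opNorm₂ _ _).trans (by gcongr)
    _ = A ^ 4 * a ^ 3 + A * ε + 1 / 2 * (A ^ 2 + A ^ 3) * a * (A ^ 5 * a ^ 2 + ε) := by ring
    _ ≤ A ^ 4 * a ^ 3 + A * ε + 1 / 2 * (A ^ 3 + A ^ 3) * a * (A ^ 5 * a ^ 2 + ε) := by
        gcongr
        all_goals norm_num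
    _ = _ := by ring

end Pointwise

/-! ### Sewing along dyadic partitions -/

section Sewing

variable {W : Type*} [NormedAddCommGroup W]

/-- The sum of `Ξ` over the partition of `[a, b]` into `2 ^ n` intervals of equal length. -/
noncomputable def dyadicSum (Ξ : ℝ → ℝ → W) : ℕ → ℝ → ℝ → W
  | 0, a, b => Ξ a b
  | n + 1, a, b => dyadicSum Ξ n a ((a + b) / 2) + dyadicSum Ξ n ((a + b) / 2) b

theorem dyadicSum_eq_sum (Ξ : ℝ → ℝ → W) (n : ℕ) (a b : ℝ) :
    dyadicSum Ξ n a b = ∑ j ∈ Finset.range (2 ^ n),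
      Ξ (a + j * ((b - a) / 2 ^ n)) (a + (j + 1) * ((b - a) / 2 ^ n)) := by
  induction n generalizing a b with
  | zero => simp [dyadicSum]
  | succ n ih =>
    rw [dyadicSum, ih, ih, pow_succ 2 n, mul_two, Finset.sum_range_add]
    congr 1
    · refine Finset.sum_congr rfl fun j _ => ?_
      congr 1 <;> ring
    · refine Finset.sum_congr rfl fun j _ => ?_
      have h : (2 : ℝ) ^ n ≠ 0 := by positivity
      congr 1 <;> push_cast <;> field_simp <;> ring

/-- The dyadic sums of an almost additive function of two times stay close to its values. -/
theorem norm_dyadicSum_sub_le {Ξ : ℝ → ℝ → W} {s t θ K c : ℝ} (hK : 0 ≤ K)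
    (hc₀ : 0 ≤ c) (hc : 1 + 2 * c * (1 / 2) ^ θ ≤ c)
    (hΞ : ∀ a u b, s ≤ a → a ≤ u → u ≤ b → b ≤ t →
      ‖Ξ a b - Ξ a u - Ξ u b‖ ≤ K * (b - a) ^ θ) (n : ℕ) (a b : ℝ) (ha : s ≤ a) (hab : a ≤ b)
    (hb : b ≤ t) : ‖dyadicSum Ξ n a b - Ξ a b‖ ≤ c * K * (b - a) ^ θ := by
  induction n generalizing a b with
  | zero =>
    simp only [dyadicSum, sub_self, norm_zero]
    have h0 : 0 ≤ b - a := by linarith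
    positivity
  | succ n ih =>
    have h0 : 0 ≤ b - a := by linarith
    set u := (a + b) / 2 with hu
    have h1 := ih a u ha (by linarith) (by linarith)
    have h2 := ih u b (by linarith) (by linarith) hb
    have h3 := hΞ a u b ha (by linarith) (by linarith) hb
    have e1 : u - a = (b - a) * (1 / 2) := by rw [hu]; ring
    have e2 : b - u = (b - a) * (1 / 2) := by rw [hu]; ring
    rw [e1, Real.mul_rpow h0 (by norm_num)] at h1
    rw [e2, Real.mul_rpow h0 (by norm_num)] at h2
    calc _ = ‖(dyadicSum Ξ n a u - Ξ a u) + (dyadicSum Ξ n u b - Ξ u b)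
          - (Ξ a b - Ξ a u - Ξ u b)‖ := by
          rw [dyadicSum, ← hu]
          congr 1
          abel
      _ ≤ c * K * ((b - a) ^ θ * (1 / 2) ^ θ) + c * K * ((b - a) ^ θ * (1 / 2) ^ θ)
          + K * (b - a) ^ θ := norm_sub_le_of_le (norm_add_le_of_le h1 h2) h3
      _ = (1 + 2 * c * (1 / 2) ^ θ) * (K * (b - a) ^ θ) := by ring
      -- The two halves contribute 2c(1/2)^θ and the midpoint defect contributes 1, so the condition
      -- on c closes the induction with the same constant.
      _ ≤ c * (K * (b - a) ^ θ) := by gcongr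
      _ = _ := by ring

end Sewing

/-! ### The rough integral as a limit of dyadic sums -/

section Integral

variable {d : ℕ} {γ : ℝ} {W : Type*} [NormedAddCommGroup W] [NormedSpace ℝ W]

variable {𝕏 : RoughPath d γ} {Y : ℝ → Vec d →L[ℝ] W} {Y1 : ℝ → Vec d →L[ℝ] Vec d →L[ℝ] W}
  {Y2 : ℝ → Vec d →L[ℝ] Vec d →L[ℝ] Vec d →L[ℝ] W} {s t : ℝ} {J J' : W}

theorem IsRoughIntegral.eq_zero (h : IsRoughIntegral 𝕏 Y Y1 Y2 s s J) : J = 0 := by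
  rw [← norm_le_zero_iff]
  refine le_of_forall_pos_lt_add fun ε hε => ?_
  obtain ⟨δ, -, h⟩ := h ε hε
  simpa using h 0 (fun _ => s) rfl rfl (by simp)

theorem eventually_div_two_pow_lt {l δ : ℝ} (hδ : 0 < δ) :
    ∀ᶠ n : ℕ in Filter.atTop, l / 2 ^ n < δ := by
  have h : Filter.Tendsto (fun n : ℕ => l * (1 / 2 : ℝ) ^ n) Filter.atTop (nhds (l * 0)) :=
    (tendsto_pow_atTop_nhds_zero_of_lt_one (by norm_num) (by norm_num)).const_mul l
  rw [mul_zero] at h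
  filter_upwards [h.eventually_lt_const hδ] with n hn
  simpa [div_eq_mul_inv] using hn

theorem IsRoughIntegral.tendsto_dyadicSum (hst : s < t)
    (h : IsRoughIntegral 𝕏 Y Y1 Y2 s t J) :
    Filter.Tendsto (fun n => dyadicSum (summand 𝕏 Y Y1 Y2) n s t) Filter.atTop (nhds J) := by
  rw [Metric.tendsto_nhds]
  intro ε hε
  obtain ⟨δ, hδ, h⟩ := h ε hε
  filter_upwards [eventually_div_two_pow_lt (l := t - s) hδ] with n hn
  have hp : 0 < (t - s) / 2 ^ n := div_pos (by linarith) (by positivity)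
  have := h (2 ^ n) (fun j => s + j * ((t - s) / 2 ^ n)) (by simp) (by push_cast; field_simp; ring)
    (fun j _ => by push_cast; constructor <;> linarith)
  rw [dist_eq_norm, dyadicSum_eq_sum]
  simpa [summand] using this

/-- The dyadic partitions of [r, s] and [s, t] concatenate to partitions of [r, t] whose mesh tends
to zero. -/
theorem IsRoughIntegral.tendsto_dyadicSum_add {r : ℝ} (hrs : r < s) (hst : s < t)
    (h : IsRoughIntegral 𝕏 Y Y1 Y2 r t J) :
    Filter.Tendsto (fun n => dyadicSum (summand 𝕏 Y Y1 Y2) n r s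
      + dyadicSum (summand 𝕏 Y Y1 Y2) n s t) Filter.atTop (nhds J) := by
  rw [Metric.tendsto_nhds]
  intro ε hε
  obtain ⟨δ, hδ, h⟩ := h ε hε
  filter_upwards [eventually_div_two_pow_lt (l := s - r) hδ,
    eventually_div_two_pow_lt (l := t - s) hδ] with n hn hn'
  have hp : 0 < (s - r) / 2 ^ n := div_pos (by linarith) (by positivity)
  have hp' : 0 < (t - s) / 2 ^ n := div_pos (by linarith) (by positivity)
  let τ : ℕ → ℝ := fun j => if j ≤ 2 ^ n then r + j * ((s - r) / 2 ^ n)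
    else s + ((j : ℝ) - 2 ^ n) * ((t - s) / 2 ^ n)
  have hτ1 : ∀ j ≤ 2 ^ n, τ j = r + j * ((s - r) / 2 ^ n) := fun j hj => if_pos hj
  have hτ2 : ∀ j, τ (2 ^ n + j) = s + j * ((t - s) / 2 ^ n) := by
    intro j
    -- At the junction the first branch of τ applies; both formulas give s there.
    rcases Nat.eq_zero_or_pos j with rfl | hj
    · rw [hτ1 _ (by simp)]
      push_cast
      field_simp
      ring
    · simp only [τ]
      rw [if_neg (by omega)]
      push_cast
      ring
  have := h (2 ^ n + 2 ^ n) τ (by simp [hτ1]) (by rw [hτ2]; push_cast; field_simp; ring)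
    (fun j hj => by
      rcases lt_or_ge j (2 ^ n) with hj' | hj'
      · rw [hτ1 j hj'.le, hτ1 (j + 1) hj']
        push_cast
        constructor <;> linarith
      · obtain ⟨k, rfl⟩ := Nat.exists_eq_add_of_le hj'
        rw [add_assoc, hτ2, hτ2]
        push_cast
        constructor <;> linarith)
  rw [Finset.sum_range_add] at this
  rw [dist_eq_norm, dyadicSum_eq_sum, dyadicSum_eq_sum]
  refine lt_of_eq_of_lt (congrArg (fun v => ‖v - J‖) (congrArg₂ (· + ·)
    (Finset.sum_congr rfl fun j hj => ?_) (Finset.sum_congr rfl fun j _ => ?_))) this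
  · have hj := Finset.mem_range.1 hj
    rw [hτ1 j hj.le, hτ1 (j + 1) hj]
    push_cast
    rfl
  · rw [add_assoc (2 ^ n) j, hτ2, hτ2]
    push_cast
    rfl

/-- The equation provides only integrals starting at time 0. Their differences are recovered as
dyadic limits on [s, t], without first constructing an integral there. -/
theorem tendsto_dyadicSum_sub {r : ℝ} (hrs : r ≤ s) (hst : s < t)
    (h : IsRoughIntegral 𝕏 Y Y1 Y2 r s J) (h' : IsRoughIntegral 𝕏 Y Y1 Y2 r t J') :
    Filter.Tendsto (fun n => dyadicSum (summand 𝕏 Y Y1 Y2) n s t) Filter.atTop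
      (nhds (J' - J)) := by
  rcases hrs.eq_or_lt with rfl | hrs
  · rw [h.eq_zero, sub_zero]
    exact h'.tendsto_dyadicSum hst
  · simpa using (h'.tendsto_dyadicSum_add hrs hst).sub (h.tendsto_dyadicSum hrs)

end Integral

/-! ### The self-improving estimate on short intervals -/

/-- All data of the equation and of the path `Z` on `[0, T]` are bounded by `A`. -/
structure PathBounds {d m : ℕ} {γ : ℝ} (𝕏 : RoughPath d γ) (V : Vec m → Vec d →L[ℝ] Vec m)
    (V₀ : Vec m → Vec m) (Z : ℝ → Vec m) (T A : ℝ) : Prop where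
  one_le : 1 ≤ A
  dim_sq_le : (d : ℝ) ^ 2 ≤ A
  dim_cube_le : (d : ℝ) ^ 3 ≤ A
  T_le : T ≤ A
  derivBounds : DerivBounds V A
  norm_Z_le : ∀ s ∈ Set.Icc 0 T, ‖Z s‖ ≤ A
  norm_V_le : ∀ s ∈ Set.Icc 0 T, ‖V (Z s)‖ ≤ A
  norm_V₀_le : ∀ s ∈ Set.Icc 0 T, ‖V₀ (Z s)‖ ≤ A
  norm_incr_Z_le : ∀ s ∈ Set.Icc 0 T, ∀ t ∈ Set.Icc 0 T, ‖Z t - Z s‖ ≤ A * |t - s| ^ γ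
  norm_X_le : ∀ s ∈ Set.Icc 0 T, ∀ t ∈ Set.Icc 0 T, ‖incr 𝕏.X s t‖ ≤ A * |t - s| ^ γ
  norm_X2_le : ∀ s ∈ Set.Icc 0 T, ∀ t ∈ Set.Icc 0 T, ‖𝕏.X2 s t‖ ≤ A ^ 2 * (|t - s| ^ γ) ^ 2
  norm_X3_le : ∀ s ∈ Set.Icc 0 T, ∀ t ∈ Set.Icc 0 T, ‖𝕏.X3 s t‖ ≤ A ^ 3 * (|t - s| ^ γ) ^ 3

theorem rpow_bounds_of_le_one {γ x : ℝ} (hγ : 1 / 4 < γ) (hx0 : 0 ≤ x) (hx1 : x ≤ 1) :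
    0 ≤ x ^ γ ∧ x ^ γ ≤ 1 ∧ 0 ≤ x ^ min (3 * γ) 1 ∧ (x ^ γ) ^ 3 ≤ x ^ min (3 * γ) 1 := by
  have hρ : 0 < min (3 * γ) 1 := lt_min (by linarith) one_pos
  refine ⟨by positivity, Real.rpow_le_one hx0 hx1 (by linarith), by positivity, ?_⟩
  rw [← Real.rpow_mul_natCast hx0]
  exact Real.rpow_le_rpow_of_exponent_ge_of_imp hx0 hx1
    (by push_cast; rw [mul_comm]; exact min_le_left _ _) (fun _ h => absurd h (by push_cast; linarith))

/-- The Hölder norms range over both orders of the two times, whereas sewing treats s < t only.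
Chen's relation for s, t, s gives X²_{t,s} = -X²_{s,t} + δX ⊗ δX, and the terms regroup. -/
theorem rem2_swap {d : ℕ} {γ : ℝ} (𝕏 : RoughPath d γ) {W : Type*} [NormedAddCommGroup W]
    [NormedSpace ℝ W] (Y : ℝ → W) (Y1 : ℝ → Vec d →L[ℝ] W)
    (Y2 : ℝ → Vec d →L[ℝ] Vec d →L[ℝ] W) (s t : ℝ) :
    rem2 𝕏 Y Y1 Y2 t s = -rem2 𝕏 Y Y1 Y2 s t + rem1 𝕏 Y1 Y2 s t (incr 𝕏.X s t)
      - (Y2 t - Y2 s) (incr 𝕏.X s t) (incr 𝕏.X s t) + act2 (Y2 t - Y2 s) (𝕏.X2 s t) := by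
  have h0 : act2 (Y2 t) (𝕏.X2 s s) = 0 := by
    have h := act2_chen 𝕏 (Y2 t) s s s
    have h' : incr 𝕏.X s s = 0 := by simp [incr]
    rwa [h', map_zero, add_zero, left_eq_add] at h
  have h1 := act2_chen 𝕏 (Y2 t) s t s
  have h2 : incr 𝕏.X t s = -incr 𝕏.X s t := by simp [incr]
  rw [h0, h2, map_neg] at h1
  have h3 : act2 (Y2 t) (𝕏.X2 t s)
      = -act2 (Y2 t) (𝕏.X2 s t) + Y2 t (incr 𝕏.X s t) (incr 𝕏.X s t) := by
    rw [← sub_eq_zero, ← sub_eq_zero.2 h1.symm]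
    abel
  simp only [rem2, rem1, h2, h3, act2_sub_left, sub_apply, map_neg]
  simp only [incr, sub_apply]
  abel

namespace PathBounds

variable {d m : ℕ} {γ : ℝ} {𝕏 : RoughPath d γ} {V : Vec m → Vec d →L[ℝ] Vec m}
  {V₀ : Vec m → Vec m} {Z : ℝ → Vec m} {T A : ℝ}

/-- Each of the three products in the defect pairs a remainder with an increment of complementary
order, so each is O((b - a)^(ρ+γ)). It matters that K enters linearly with a factor polynomial in A.
-/
theorem norm_summand_sub_le (h : PathBounds 𝕏 V V₀ Z T A) (hγ : 1 / 4 < γ)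
    (hg : 𝕏.IsGeometric) {a u b K : ℝ} (hK : 0 ≤ K) (ha : 0 ≤ a) (hau : a ≤ u) (hub : u ≤ b)
    (hb : b ≤ T) (hab : b - a ≤ 1)
    (hR : ‖rem2 𝕏 Z (fun t => V (Z t)) (fun t => DVV V (Z t)) a u‖
      ≤ K * (u - a) ^ min (3 * γ) 1) :
    ‖summand 𝕏 (fun t => V (Z t)) (fun t => DVV V (Z t)) (fun t => DDVV V (Z t)) a b
      - summand 𝕏 (fun t => V (Z t)) (fun t => DVV V (Z t)) (fun t => DDVV V (Z t)) a u
      - summand 𝕏 (fun t => V (Z t)) (fun t => DVV V (Z t)) (fun t => DDVV V (Z t)) u b‖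
    ≤ (13 * A ^ 10 + 4 * A ^ 5 * K) * (b - a) ^ (min (3 * γ) 1 + γ) := by
  have hA := h.one_le
  have hρ : 0 < min (3 * γ) 1 := lt_min (by linarith) one_pos
  have ma : a ∈ Set.Icc 0 T := ⟨ha, by linarith⟩
  have mu : u ∈ Set.Icc 0 T := ⟨by linarith, by linarith⟩
  have mb : b ∈ Set.Icc 0 T := ⟨by linarith, hb⟩
  obtain ⟨δ0, δ1, η0, δη⟩ := rpow_bounds_of_le_one hγ (sub_nonneg.2 (hau.trans hub)) hab
  have hua : |u - a| ^ γ ≤ (b - a) ^ γ := by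
    rw [abs_of_nonneg (by linarith)]
    exact Real.rpow_le_rpow (by linarith) (by linarith) (by linarith)
  have hbu : |b - u| ^ γ ≤ (b - a) ^ γ := by
    rw [abs_of_nonneg (by linarith)]
    exact Real.rpow_le_rpow (by linarith) (by linarith) (by linarith)
  have hη : (u - a) ^ min (3 * γ) 1 ≤ (b - a) ^ min (3 * γ) 1 :=
    Real.rpow_le_rpow (by linarith) (by linarith) hρ.le
  rw [Real.rpow_add_of_nonneg (by linarith) hρ.le (by linarith)]
  set δ := (b - a) ^ γ
  set η := (b - a) ^ min (3 * γ) 1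
  have hw : ‖Z u - Z a‖ ≤ A * δ := (h.norm_incr_Z_le a ma u mu).trans (by gcongr)
  have hξ : ‖incr 𝕏.X a u‖ ≤ A * δ := (h.norm_X_le a ma u mu).trans (by gcongr)
  have hξ' : ‖incr 𝕏.X u b‖ ≤ A * δ := (h.norm_X_le u mu b mb).trans (by gcongr)
  have hx2 : ‖𝕏.X2 a u‖ ≤ A ^ 2 * δ ^ 2 := (h.norm_X2_le a ma u mu).trans (by gcongr)
  have hx2' : ‖𝕏.X2 u b‖ ≤ A ^ 2 * δ ^ 2 := (h.norm_X2_le u mu b mb).trans (by gcongr)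
  have hx3 : ‖𝕏.X3 u b‖ ≤ A ^ 3 * δ ^ 3 := (h.norm_X3_le u mu b mb).trans (by gcongr)
  have he : ‖Z u - Z a - V (Z a) (incr 𝕏.X a u) - act2 (DVV V (Z a)) (𝕏.X2 a u)‖ ≤ K * η :=
    hR.trans (by gcongr)
  have Va := h.norm_V_le a ma
  have Vu := h.norm_V_le u mu
  have b1 := norm_rem2_V_le hA h.dim_sq_le h.derivBounds Va δ0 hw hξ hx2
    (fun i j => hg.1 a u i j) he
  have b2 := norm_rem1_DVV_le hA h.dim_sq_le h.derivBounds Va Vu hw hx2 he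
  have b3 : ‖DDVV V (Z u) - DDVV V (Z a)‖ ≤ 6 * A ^ 3 * (A * δ) :=
    (norm_DDVV_sub_le h.derivBounds Va Vu).trans (by gcongr)
  have c1 := (ContinuousLinearMap.le_opNorm (V (Z u) - V (Z a) - DVV V (Z a) (incr 𝕏.X a u)
    - act2 (DDVV V (Z a)) (𝕏.X2 a u)) (incr 𝕏.X u b)).trans
    (mul_le_mul b1 hξ' (norm_nonneg _) ((norm_nonneg _).trans b1))
  have c2 := norm_act2_le_of_le h.dim_sq_le b2 hx2'
  have c3 := norm_act3_le_of_le h.dim_cube_le b3 hx3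
  have hA4 : A ^ 4 ≤ A ^ 5 := pow_le_pow_right₀ hA (by norm_num)
  have hA2 : A ^ 2 ≤ A ^ 5 := pow_le_pow_right₀ hA (by norm_num)
  -- Here δ = (b - a)^γ and η = (b - a)^ρ; since b - a ≤ 1 and ρ ≤ 3γ, one has δ^3 ≤ η.
  have δ4 : δ ^ 4 ≤ η * δ := by
    calc δ ^ 4 = δ ^ 3 * δ := by ring
      _ ≤ η * δ := by gcongr
  have ηδ2 : η * δ ^ 2 ≤ η * δ := by
    calc η * δ ^ 2 = η * δ * δ := by ring
      _ ≤ η * δ * 1 := by gcongr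
      _ = η * δ := mul_one _
  rw [summand_sub_summand, norm_neg]
  refine (norm_add_le_of_le (norm_add_le_of_le c1 c2) c3).trans ?_
  have hηδ : 0 ≤ η * δ := by positivity
  calc _ = (A ^ 5 + A ^ 9) * δ ^ 4 + A ^ 2 * K * (η * δ) + A ^ 4 * K * (η * δ ^ 2)
        + (5 * A ^ 10) * δ ^ 4 + 2 * A ^ 5 * K * (η * δ ^ 2) + 6 * A ^ 8 * δ ^ 4 := by ring
    _ ≤ (A ^ 10 + A ^ 10) * (η * δ) + A ^ 5 * K * (η * δ) + A ^ 5 * K * (η * δ)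
        + (5 * A ^ 10) * (η * δ) + 2 * A ^ 5 * K * (η * δ) + 6 * A ^ 10 * (η * δ) := by
        gcongr <;> first | exact hA | norm_num
    _ = _ := by ring

theorem continuousOn (h : PathBounds 𝕏 V V₀ Z T A) (hγ : 1 / 4 < γ) :
    ContinuousOn Z (Set.Icc 0 T) := by
  intro s hs
  rw [ContinuousWithinAt, tendsto_iff_norm_sub_tendsto_zero]
  have hc : Continuous fun t : ℝ => A * |t - s| ^ γ := by
    have : Continuous fun t : ℝ => |t - s| ^ γ :=
      (continuous_abs.comp (continuous_id.sub continuous_const)).rpow_const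
        fun _ => Or.inr (by linarith)
    exact continuous_const.mul this
  have h0 : Filter.Tendsto (fun t : ℝ => A * |t - s| ^ γ) (nhdsWithin s (Set.Icc 0 T))
      (nhds 0) := by
    have := (hc.tendsto s).mono_left (nhdsWithin_le_nhds (s := Set.Icc 0 T))
    rwa [sub_self, abs_zero, Real.zero_rpow (by linarith), mul_zero] at this
  refine squeeze_zero' (Filter.Eventually.of_forall fun t => norm_nonneg _) ?_ h0
  filter_upwards [self_mem_nhdsWithin] with t ht using h.norm_incr_Z_le s hs t ht

theorem intervalIntegrable (h : PathBounds 𝕏 V V₀ Z T A) (hγ : 1 / 4 < γ)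
    (hV₀ : Continuous V₀) {a b : ℝ} (ha : a ∈ Set.Icc 0 T) (hb : b ∈ Set.Icc 0 T) :
    IntervalIntegrable (fun τ => V₀ (Z τ)) MeasureTheory.volume a b := by
  refine ContinuousOn.intervalIntegrable ?_
  exact (hV₀.comp_continuousOn (h.continuousOn hγ)).mono (Set.uIcc_subset_Icc ha hb)

/-- A bound on short intervals of the remainder of a solution yields a better bound. -/
theorem norm_rem2_le_of_le (h : PathBounds 𝕏 V V₀ Z T A) (hγ : 1 / 4 < γ)
    (hg : 𝕏.IsGeometric) (hV₀ : Continuous V₀) {z₀ : Vec m} (hZ : IsSolution 𝕏 V V₀ z₀ Z)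
    {c ℓ K : ℝ} (hc₀ : 0 ≤ c) (hc : 1 + 2 * c * (1 / 2) ^ (min (3 * γ) 1 + γ) ≤ c)
    (hℓ : ℓ ≤ 1) (hℓ' : 8 * c * A ^ 5 * ℓ ^ γ ≤ 1) (hK : 0 ≤ K)
    (hR : ∀ a b, 0 ≤ a → a ≤ b → b ≤ T → b - a ≤ ℓ →
      ‖rem2 𝕏 Z (fun t => V (Z t)) (fun t => DVV V (Z t)) a b‖ ≤ K * (b - a) ^ min (3 * γ) 1)
    {a b : ℝ} (ha : 0 ≤ a) (hab : a < b) (hb : b ≤ T) (hba : b - a ≤ ℓ) :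
    ‖rem2 𝕏 Z (fun t => V (Z t)) (fun t => DVV V (Z t)) a b‖
      ≤ (5 * A ^ 10 + K / 2) * (b - a) ^ min (3 * γ) 1 := by
  have hA := h.one_le
  have hρ : 0 < min (3 * γ) 1 := lt_min (by linarith) one_pos
  have hb0 : 0 < b - a := by linarith
  have ma : a ∈ Set.Icc 0 T := ⟨ha, by linarith⟩
  have mb : b ∈ Set.Icc 0 T := ⟨by linarith, hb⟩
  have m0 : (0 : ℝ) ∈ Set.Icc 0 T := ⟨le_rfl, by linarith⟩
  obtain ⟨J, hJ, hJZ⟩ := hZ.2 a ha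
  obtain ⟨J', hJ', hJZ'⟩ := hZ.2 b (by linarith)
  obtain ⟨δ0, δ1, η0, δη⟩ := rpow_bounds_of_le_one hγ hb0.le (hba.trans hℓ)
  have hlim := tendsto_dyadicSum_sub ha hab hJ hJ'
  set Ξ := summand 𝕏 (fun t => V (Z t)) (fun t => DVV V (Z t)) (fun t => DDVV V (Z t)) with hΞ
  have hsew : ‖J' - J - Ξ a b‖
      ≤ c * (13 * A ^ 10 + 4 * A ^ 5 * K) * (b - a) ^ (min (3 * γ) 1 + γ) := by
    refine le_of_tendsto (hlim.sub_const _).norm (Filter.Eventually.of_forall fun n => ?_)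
    refine norm_dyadicSum_sub_le (s := a) (t := b) (by positivity) hc₀ hc ?_ n a b le_rfl hab.le
      le_rfl
    intro a' u b' h1 h2 h3 h4
    exact h.norm_summand_sub_le hγ hg hK (by linarith) h2 h3 (by linarith) (by linarith)
      (hR a' u (by linarith) h2 (by linarith) (by linarith))
  have hint : ‖∫ τ in a..b, V₀ (Z τ)‖ ≤ A * (b - a) := by
    have := intervalIntegral.norm_integral_le_of_norm_le_const (f := fun τ => V₀ (Z τ))
      (a := a) (b := b) (C := A) fun x hx => by
        rw [Set.uIoc_of_le hab.le] at hx
        exact h.norm_V₀_le x ⟨by linarith [hx.1], by linarith [hx.2]⟩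
    rwa [abs_of_pos hb0] at this
  have hdiff : Z b - Z a = J' - J + ∫ τ in a..b, V₀ (Z τ) := by
    rw [← intervalIntegral.integral_interval_sub_left
      (h.intervalIntegrable hγ hV₀ m0 mb) (h.intervalIntegrable hγ hV₀ m0 ma), hJZ, hJZ']
    abel
  have h3 : ‖act3 (DDVV V (Z a)) (𝕏.X3 a b)‖ ≤ A * (2 * A ^ 3 * (A ^ 3 * ((b - a) ^ γ) ^ 3)) := by
    have := h.norm_X3_le a ma b mb
    rw [abs_of_pos hb0] at this
    exact norm_act3_le_of_le h.dim_cube_le (norm_DDVV_le h.derivBounds (h.norm_V_le a ma)) this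
  have hδℓ : 8 * c * A ^ 5 * (b - a) ^ γ ≤ 1 :=
    le_trans (by gcongr) hℓ'
  -- The drift is of order 1, which is where the cap ρ ≤ 1 is needed.
  have hη1 : b - a ≤ (b - a) ^ min (3 * γ) 1 := by
    conv_lhs => rw [← Real.rpow_one (b - a)]
    exact Real.rpow_le_rpow_of_exponent_ge hb0 (hba.trans hℓ) (min_le_right _ _)
  rw [Real.rpow_add hb0] at hsew
  set δ := (b - a) ^ γ
  set η := (b - a) ^ min (3 * γ) 1
  have hcδ : c * δ ≤ 1 / 8 := by
    have h5 : c * δ * 1 ≤ c * δ * A ^ 5 := by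
      gcongr
      exact one_le_pow₀ hA
    nlinarith
  have hA7 : A ^ 7 ≤ A ^ 10 := pow_le_pow_right₀ hA (by norm_num)
  have hA1 : A ≤ A ^ 10 := le_self_pow₀ hA (by norm_num)
  -- By the equation Z^# is the sewing error plus the X³ term plus the drift. The K-free constants
  -- add up to 13/8 + 2 + 1 ≤ 5, and the choice of ℓ halves K.
  calc _ = ‖(J' - J - Ξ a b) + act3 (DDVV V (Z a)) (𝕏.X3 a b) + ∫ τ in a..b, V₀ (Z τ)‖ := by
        rw [rem2, incr, hdiff, hΞ, summand]
        congr 1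
        abel
    _ ≤ c * (13 * A ^ 10 + 4 * A ^ 5 * K) * (η * δ)
        + A * (2 * A ^ 3 * (A ^ 3 * δ ^ 3)) + A * (b - a) :=
        norm_add_le_of_le (norm_add_le_of_le hsew h3) hint
    _ = 13 * A ^ 10 * η * (c * δ) + (8 * c * A ^ 5 * δ) * (K / 2 * η)
        + 2 * A ^ 7 * δ ^ 3 + A * (b - a) := by ring
    _ ≤ 13 * A ^ 10 * η * (1 / 8) + 1 * (K / 2 * η) + 2 * A ^ 10 * η + A ^ 10 * η := by
        gcongr
    _ ≤ _ := by
        have : 0 ≤ A ^ 10 * η := by positivity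
        nlinarith

/-- The map K ↦ 5 A^10 + K/2 contracts to its fixed point 10 A^10, so any finite initial K
disappears in the limit. The induction runs over all short intervals at once, because an improvement
on one interval uses the bound on its subintervals. -/
theorem norm_rem2_le_of_short (h : PathBounds 𝕏 V V₀ Z T A) (hγ : 1 / 4 < γ)
    (hg : 𝕏.IsGeometric) (hV₀ : Continuous V₀) {z₀ : Vec m} (hZ : IsSolution 𝕏 V V₀ z₀ Z)
    {c ℓ K : ℝ} (hc₀ : 0 ≤ c) (hc : 1 + 2 * c * (1 / 2) ^ (min (3 * γ) 1 + γ) ≤ c)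
    (hℓ : ℓ ≤ 1) (hℓ' : 8 * c * A ^ 5 * ℓ ^ γ ≤ 1) (hK : 0 ≤ K)
    (hR : ∀ a b, 0 ≤ a → a < b → b ≤ T →
      ‖rem2 𝕏 Z (fun t => V (Z t)) (fun t => DVV V (Z t)) a b‖ ≤ K * (b - a) ^ min (3 * γ) 1)
    {a b : ℝ} (ha : 0 ≤ a) (hab : a < b) (hb : b ≤ T) (hba : b - a ≤ ℓ) :
    ‖rem2 𝕏 Z (fun t => V (Z t)) (fun t => DVV V (Z t)) a b‖
      ≤ 10 * A ^ 10 * (b - a) ^ min (3 * γ) 1 := by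
  have hA := h.one_le
  have hρ : 0 < min (3 * γ) 1 := lt_min (by linarith) one_pos
  have key : ∀ (n : ℕ) (a b : ℝ), 0 ≤ a → a < b → b ≤ T → b - a ≤ ℓ →
      ‖rem2 𝕏 Z (fun t => V (Z t)) (fun t => DVV V (Z t)) a b‖
        ≤ (10 * A ^ 10 + K * (1 / 2) ^ n) * (b - a) ^ min (3 * γ) 1 := by
    intro n
    induction n with
    | zero =>
      intro a b ha hab hb _
      have : 0 < b - a := by linarith
      refine (hR a b ha hab hb).trans ?_
      gcongr
      rw [pow_zero, mul_one]
      linarith [show 0 ≤ 10 * A ^ 10 by positivity]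
    | succ n ih =>
      intro a b ha hab hb hba
      refine (h.norm_rem2_le_of_le hγ hg hV₀ hZ hc₀ hc hℓ hℓ'
        (K := 10 * A ^ 10 + K * (1 / 2) ^ n) (by positivity) ?_ ha hab hb hba).trans_eq ?_
      · intro a' b' ha' hab' hb' hba'
        -- Degenerate intervals must be allowed for the defect estimate; on them the remainder and
        -- 0^ρ both vanish.
        rcases hab'.eq_or_lt with rfl | hlt
        · have hs : act2 (DVV V (Z a')) (𝕏.X2 a' a') = 0 := by
            have h2 := h.norm_X2_le a' ⟨ha', hb'⟩ a' ⟨ha', hb'⟩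
            rw [sub_self, abs_zero, Real.zero_rpow (by linarith)] at h2
            have h3 : 𝕏.X2 a' a' = 0 := by simpa using h2
            rw [h3]
            simp [act2]
          rw [rem2, hs]
          simp only [incr, sub_self, map_zero, norm_zero]
          rw [Real.zero_rpow hρ.ne', mul_zero]
        · exact ih a' b' ha' hlt hb' hba'
      · ring
  have hlim : Filter.Tendsto (fun n : ℕ => (10 * A ^ 10 + K * (1 / 2 : ℝ) ^ n)
      * (b - a) ^ min (3 * γ) 1) Filter.atTop
      (nhds ((10 * A ^ 10 + K * 0) * (b - a) ^ min (3 * γ) 1)) :=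
    (((tendsto_pow_atTop_nhds_zero_of_lt_one (by norm_num) (by norm_num)).const_mul K).const_add
      _).mul_const _
  rw [mul_zero, add_zero] at hlim
  exact ge_of_tendsto' hlim fun n => key n a b ha hab hb hba

end PathBounds

/-! ### From norms to pointwise inequalities and back -/

section Norms

variable {W : Type*} [NormedAddCommGroup W]

theorem supNorm_le {I : Set ℝ} {ξ : ℝ → W} {C : ℝ} (h : ∀ s ∈ I, ‖ξ s‖ ≤ C) :
    supNorm I ξ ≤ ENNReal.ofReal C :=
  iSup₂_le fun s hs => ENNReal.ofReal_le_ofReal (h s hs)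

theorem norm_le_of_supNorm_le {I : Set ℝ} {ξ : ℝ → W} {C : ℝ} (hC : 0 ≤ C)
    (h : supNorm I ξ ≤ ENNReal.ofReal C) {s : ℝ} (hs : s ∈ I) : ‖ξ s‖ ≤ C :=
  (ENNReal.ofReal_le_ofReal_iff hC).1
    ((le_iSup₂ (f := fun s _ => ENNReal.ofReal ‖ξ s‖) s hs).trans h)

theorem holderNorm_le {α : ℝ} {I : Set ℝ} {F : ℝ → ℝ → W} {C : ℝ}
    (h : ∀ s ∈ I, ∀ t ∈ I, s ≠ t → ‖F s t‖ ≤ C * |t - s| ^ α) :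
    holderNorm α I F ≤ ENNReal.ofReal C := by
  refine iSup₂_le fun s hs => iSup₂_le fun t ht => iSup_le fun hst => ?_
  have : 0 < |t - s| := abs_pos.2 (sub_ne_zero.2 hst.symm)
  exact ENNReal.ofReal_le_ofReal ((div_le_iff₀ (by positivity)).2 (h s hs t ht hst))

theorem norm_le_of_holderNorm_le {α : ℝ} {I : Set ℝ} {F : ℝ → ℝ → W} {C : ℝ} (hC : 0 ≤ C)
    (h : holderNorm α I F ≤ ENNReal.ofReal C) {s t : ℝ} (hs : s ∈ I) (ht : t ∈ I)
    (hst : s ≠ t) : ‖F s t‖ ≤ C * |t - s| ^ α := by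
  have : 0 < |t - s| := abs_pos.2 (sub_ne_zero.2 hst.symm)
  rw [← div_le_iff₀ (by positivity)]
  refine (ENNReal.ofReal_le_ofReal_iff hC).1 (le_trans ?_ h)
  exact (le_iSup (fun _ : s ≠ t => ENNReal.ofReal (‖F s t‖ / |t - s| ^ α)) hst).trans
    ((le_iSup₂ (f := fun t _ => ⨆ _ : s ≠ t, ENNReal.ofReal (‖F s t‖ / |t - s| ^ α)) t ht).trans
      (le_iSup₂ (f := fun s _ => ⨆ t ∈ I, ⨆ _ : s ≠ t,
        ENNReal.ofReal (‖F s t‖ / |t - s| ^ α)) s hs))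

theorem norm_le_of_holderNorm_lt_top {α : ℝ} {I : Set ℝ} {F : ℝ → ℝ → W}
    (h : holderNorm α I F < ∞) {s t : ℝ} (hs : s ∈ I) (ht : t ∈ I)
    (hst : s ≠ t) : ‖F s t‖ ≤ (holderNorm α I F).toReal * |t - s| ^ α :=
  norm_le_of_holderNorm_le ENNReal.toReal_nonneg (ENNReal.ofReal_toReal h.ne).ge hs ht hst

end Norms

namespace RoughPath

variable {d : ℕ} {γ : ℝ} (𝕏 : RoughPath d γ)

theorem X2_self (s : ℝ) : 𝕏.X2 s s = 0 := by
  ext ⟨i, j⟩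
  have h := 𝕏.chen2 s s s i j
  simp only [incr, sub_self, PiLp.zero_apply, mul_zero, add_zero] at h ⊢
  linarith

theorem X3_self (s : ℝ) : 𝕏.X3 s s = 0 := by
  ext ⟨i, j, k⟩
  have h := 𝕏.chen3 s s s i j k
  simp only [incr, sub_self, PiLp.zero_apply, mul_zero, zero_mul, add_zero] at h ⊢
  linarith

theorem norm_nonneg (a b : ℝ) : 0 ≤ 𝕏.norm a b :=
  le_max_of_le_left ENNReal.toReal_nonneg

variable {a b s t : ℝ}

theorem norm_X_le (hs : s ∈ Set.Icc a b) (ht : t ∈ Set.Icc a b) :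
    ‖incr 𝕏.X s t‖ ≤ 𝕏.norm a b * |t - s| ^ γ := by
  rcases eq_or_ne s t with rfl | hst
  · simp only [incr, sub_self, norm_zero]
    have := 𝕏.norm_nonneg a b
    positivity
  · refine (norm_le_of_holderNorm_lt_top (𝕏.holder_X a b) hs ht hst).trans ?_
    gcongr
    exact le_max_left _ _

theorem norm_X2_le (hs : s ∈ Set.Icc a b) (ht : t ∈ Set.Icc a b) :
    ‖𝕏.X2 s t‖ ≤ 𝕏.norm a b ^ 2 * (|t - s| ^ γ) ^ 2 := by
  rcases eq_or_ne s t with rfl | hst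
  · rw [X2_self, _root_.norm_zero]
    positivity
  · refine (norm_le_of_holderNorm_lt_top (𝕏.holder_X2 a b) hs ht hst).trans ?_
    rw [← Real.rpow_mul_natCast (abs_nonneg _), mul_comm γ]
    push_cast
    gcongr
    have h : √(holderNorm (2 * γ) (Set.Icc a b) 𝕏.X2).toReal ≤ 𝕏.norm a b :=
      (le_max_left _ _).trans (le_max_right _ _)
    exact (Real.sqrt_le_left (𝕏.norm_nonneg a b)).1 h

theorem norm_X3_le (hs : s ∈ Set.Icc a b) (ht : t ∈ Set.Icc a b) :
    ‖𝕏.X3 s t‖ ≤ 𝕏.norm a b ^ 3 * (|t - s| ^ γ) ^ 3 := by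
  have h0 := 𝕏.norm_nonneg a b
  rcases eq_or_ne s t with rfl | hst
  · rw [X3_self, _root_.norm_zero]
    positivity
  · refine (norm_le_of_holderNorm_lt_top (𝕏.holder_X3 a b) hs ht hst).trans ?_
    rw [← Real.rpow_mul_natCast (abs_nonneg _), mul_comm γ]
    push_cast
    gcongr
    have h : (holderNorm (3 * γ) (Set.Icc a b) 𝕏.X3).toReal ^ (1 / 3 : ℝ) ≤ 𝕏.norm a b :=
      (le_max_right _ _).trans (le_max_right _ _)
    calc _ = ((holderNorm (3 * γ) (Set.Icc a b) 𝕏.X3).toReal ^ (1 / 3 : ℝ)) ^ 3 := by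
          rw [← Real.rpow_mul_natCast ENNReal.toReal_nonneg]
          norm_num
      _ ≤ _ := by gcongr

end RoughPath

/-! ### Reversed times, long intervals and the full controlled norms -/

namespace PathBounds

variable {d m : ℕ} {γ : ℝ} {𝕏 : RoughPath d γ} {V : Vec m → Vec d →L[ℝ] Vec m}
  {V₀ : Vec m → Vec m} {Z : ℝ → Vec m} {T A : ℝ}

/-- All correction terms in `rem2_swap` have order at least ρ, so reversing time costs only a power
of A. -/
theorem norm_rem2_swap_le (h : PathBounds 𝕏 V V₀ Z T A) (hγ : 1 / 4 < γ)
    {a b K : ℝ} (hK : 0 ≤ K) (ha : 0 ≤ a) (hab : a < b) (hb : b ≤ T) (hba : b - a ≤ 1)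
    (hR : ‖rem2 𝕏 Z (fun t => V (Z t)) (fun t => DVV V (Z t)) a b‖
      ≤ K * (b - a) ^ min (3 * γ) 1) :
    ‖rem2 𝕏 Z (fun t => V (Z t)) (fun t => DVV V (Z t)) b a‖
      ≤ (6 * A ^ 7 + 2 * A ^ 2 * K) * (b - a) ^ min (3 * γ) 1 := by
  have hA := h.one_le
  have hb0 : 0 < b - a := by linarith
  have ma : a ∈ Set.Icc 0 T := ⟨ha, by linarith⟩
  have mb : b ∈ Set.Icc 0 T := ⟨by linarith, hb⟩
  obtain ⟨δ0, δ1, η0, δη⟩ := rpow_bounds_of_le_one hγ hb0.le hba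
  have hw := h.norm_incr_Z_le a ma b mb
  have hξ := h.norm_X_le a ma b mb
  have hx2 := h.norm_X2_le a ma b mb
  rw [abs_of_pos hb0] at hw hξ hx2
  set δ := (b - a) ^ γ
  set η := (b - a) ^ min (3 * γ) 1
  have b1 : ‖rem1 𝕏 (fun t => V (Z t)) (fun t => DVV V (Z t)) a b‖
      ≤ 2 * A ^ 6 * δ ^ 2 + A * (K * η) :=
    norm_rem1_V_le hA h.dim_sq_le h.derivBounds (h.norm_V_le a ma) hw hx2 hR
  have b2 : ‖DVV V (Z b) - DVV V (Z a)‖ ≤ 2 * A ^ 2 * (A * δ) :=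
    (norm_DVV_sub_le h.derivBounds (h.norm_V_le b mb)).trans (by gcongr)
  have c1 := (ContinuousLinearMap.le_opNorm (rem1 𝕏 (fun t => V (Z t)) (fun t => DVV V (Z t)) a b)
    (incr 𝕏.X a b)).trans (mul_le_mul b1 hξ (norm_nonneg _) ((norm_nonneg _).trans b1))
  have c2 : ‖(DVV V (Z b) - DVV V (Z a)) (incr 𝕏.X a b) (incr 𝕏.X a b)‖
      ≤ 2 * A ^ 2 * (A * δ) * (A * δ) * (A * δ) :=
    (ContinuousLinearMap.le_opNorm₂ _ _ _).trans (by gcongr)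
  have c3 := norm_act2_le_of_le h.dim_sq_le b2 hx2
  have h5 : A ^ 5 ≤ A ^ 7 := pow_le_pow_right₀ hA (by norm_num)
  have h6 : A ^ 6 ≤ A ^ 7 := pow_le_pow_right₀ hA (by norm_num)
  have h2 : 1 ≤ A ^ 2 := one_le_pow₀ hA
  rw [rem2_swap]
  have c0 : ‖-rem2 𝕏 Z (fun t => V (Z t)) (fun t => DVV V (Z t)) a b‖ ≤ K * η := by
    rwa [norm_neg]
  refine (norm_add_le_of_le (norm_sub_le_of_le (norm_add_le_of_le c0 c1) c2) c3).trans ?_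
  have hKη : 0 ≤ K * η := by positivity
  calc _ = 1 * (K * η) + 2 * A ^ 7 * δ ^ 3 + A ^ 2 * (K * η) * δ + 2 * A ^ 5 * δ ^ 3
        + 2 * A ^ 6 * δ ^ 3 := by ring
    _ ≤ A ^ 2 * (K * η) + 2 * A ^ 7 * η + A ^ 2 * (K * η) * 1 + 2 * A ^ 7 * η
        + 2 * A ^ 7 * η := by gcongr
    _ = _ := by ring

theorem abs_sub_rpow_le (h : PathBounds 𝕏 V V₀ Z T A) {s t α : ℝ} (hs : s ∈ Set.Icc 0 T)
    (ht : t ∈ Set.Icc 0 T) (hα0 : 0 ≤ α) (hα : α ≤ 1) : |t - s| ^ α ≤ A := by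
  have hle : |t - s| ≤ A :=
    (abs_le.2 ⟨by linarith [hs.2, ht.1], by linarith [hs.1, ht.2]⟩ : |t - s| ≤ T).trans h.T_le
  calc |t - s| ^ α ≤ A ^ α := Real.rpow_le_rpow (abs_nonneg _) hle hα0
    _ ≤ A ^ (1 : ℝ) := Real.rpow_le_rpow_of_exponent_le h.one_le hα
    _ = A := Real.rpow_one A

/-- The a priori bound of the second-order remainder of a solution. -/
theorem norm_rem2_le (h : PathBounds 𝕏 V V₀ Z T A) (hγ : 1 / 4 < γ) (hγ' : γ ≤ 1 / 2)
    (hg : 𝕏.IsGeometric) (hV₀ : Continuous V₀) {z₀ : Vec m} (hZ : IsSolution 𝕏 V V₀ z₀ Z)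
    {c : ℝ} (hc₁ : 1 ≤ c) (hc : 1 + 2 * c * (1 / 2) ^ (min (3 * γ) 1 + γ) ≤ c)
    {s t : ℝ} (hs : s ∈ Set.Icc 0 T) (ht : t ∈ Set.Icc 0 T) (hst : s ≠ t) :
    ‖rem2 𝕏 Z (fun t => V (Z t)) (fun t => DVV V (Z t)) s t‖
      ≤ 2048 * c ^ 3 * A ^ 22 * |t - s| ^ min (3 * γ) 1 := by
  have hA := h.one_le
  have hρ : 0 < min (3 * γ) 1 := lt_min (by linarith) one_pos
  have hT : 0 < T := by
    rcases hst.lt_or_gt with hlt | hlt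
    · linarith [hs.1, ht.2]
    · linarith [hs.2, ht.1]
  have hM : 1 ≤ 8 * c * A ^ 5 := by
    have := one_le_pow₀ hA (n := 5)
    nlinarith
  set M := 8 * c * A ^ 5 with hMdef
  -- The largest ℓ with M ℓ^γ ≤ 1, the smallness condition of the contraction.
  set ℓ := M ^ (-γ⁻¹) with hℓdef
  have hℓ0 : 0 < ℓ := by positivity
  have hℓ1 : ℓ ≤ 1 := Real.rpow_le_one_of_one_le_of_nonpos hM (by
    have : 0 < γ⁻¹ := inv_pos.2 (by linarith)
    linarith)
  have hℓγ : ℓ ^ γ = M⁻¹ := by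
    rw [hℓdef, ← Real.rpow_mul (by linarith), neg_mul, inv_mul_cancel₀ (by linarith),
      Real.rpow_neg_one]
  have hMℓ : 8 * c * A ^ 5 * ℓ ^ γ ≤ 1 := by
    rw [hℓγ, ← hMdef, mul_inv_cancel₀ (by linarith)]
  have hpos : 0 < |t - s| := abs_pos.2 (sub_ne_zero.2 hst.symm)
  rcases le_or_gt |t - s| ℓ with hle | hgt
  · obtain ⟨-, -, -, -, hfin⟩ := hZ.1 T hT
    have hshort : ∀ a b, 0 ≤ a → a < b → b ≤ T → b - a ≤ ℓ →
        ‖rem2 𝕏 Z (fun t => V (Z t)) (fun t => DVV V (Z t)) a b‖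
          ≤ 10 * A ^ 10 * (b - a) ^ min (3 * γ) 1 := by
      have hR : ∀ a b, 0 ≤ a → a < b → b ≤ T →
          ‖rem2 𝕏 Z (fun t => V (Z t)) (fun t => DVV V (Z t)) a b‖ ≤ (holderNorm (min (3 * γ) 1)
            (Set.Icc 0 T) (rem2 𝕏 Z (fun t => V (Z t)) fun t => DVV V (Z t))).toReal
              * (b - a) ^ min (3 * γ) 1 := by
        intro a b ha hab hb
        have := norm_le_of_holderNorm_lt_top hfin (s := a) (t := b) ⟨ha, by linarith⟩
          ⟨by linarith, hb⟩ hab.ne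
        rwa [abs_of_pos (by linarith)] at this
      intro a b ha hab hb hba
      exact h.norm_rem2_le_of_short hγ hg hV₀ hZ (by linarith) hc hℓ1 hMℓ
        ENNReal.toReal_nonneg hR ha hab hb hba
    have hc3 : 1 ≤ c ^ 3 := one_le_pow₀ hc₁
    have hA22 : A ^ 10 ≤ A ^ 22 := pow_le_pow_right₀ hA (by norm_num)
    have hA22' : A ^ 7 ≤ A ^ 22 := pow_le_pow_right₀ hA (by norm_num)
    have hA22'' : A ^ 12 ≤ A ^ 22 := pow_le_pow_right₀ hA (by norm_num)
    have hA0 : 0 ≤ A ^ 22 := by positivity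
    rcases hst.lt_or_gt with hlt | hlt
    · rw [abs_of_pos (by linarith)] at hle ⊢
      refine (hshort s t hs.1 hlt ht.2 hle).trans ?_
      gcongr
      nlinarith
    · rw [abs_sub_comm, abs_of_pos (by linarith)] at hle ⊢
      refine (h.norm_rem2_swap_le hγ (by positivity) ht.1 hlt hs.2 (hle.trans hℓ1)
        (hshort t s ht.1 hlt hs.2 hle)).trans ?_
      have : 0 ≤ s - t := by linarith
      gcongr
      have e : 2 * A ^ 2 * (10 * A ^ 10) = 20 * A ^ 12 := by ring
      rw [e]
      nlinarith
  · have hδ := h.abs_sub_rpow_le hs ht (α := γ) (by linarith) (by linarith)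
    have hδ0 : 0 ≤ |t - s| ^ γ := by positivity
    -- For |t - s| > ℓ one has |t - s|^ρ ≥ ℓ^(3γ) = M^(-3). The trivial bound 4 A^7 thus becomes 4
    -- A^7 M^3 = 2048 c^3 A^22 times |t - s|^ρ.
    have hfar : 1 ≤ M ^ 3 * |t - s| ^ min (3 * γ) 1 := by
      have h1 : ℓ ^ (3 * γ) ≤ |t - s| ^ min (3 * γ) 1 :=
        (Real.rpow_le_rpow_of_exponent_ge hℓ0 hℓ1 (min_le_left _ _)).trans
          (Real.rpow_le_rpow hℓ0.le hgt.le hρ.le)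
      have h2 : ℓ ^ (3 * γ) = (M⁻¹) ^ 3 := by
        rw [← hℓγ, ← Real.rpow_mul_natCast hℓ0.le, mul_comm]
        norm_num
      calc (1 : ℝ) = M ^ 3 * (M⁻¹) ^ 3 := by
            rw [← mul_pow, mul_inv_cancel₀ (by linarith), one_pow]
        _ ≤ _ := by
            rw [← h2]
            gcongr
    have n1 : ‖Z t - Z s‖ ≤ A + A := norm_sub_le_of_le (h.norm_Z_le t ht) (h.norm_Z_le s hs)
    have n2 : ‖V (Z s) (incr 𝕏.X s t)‖ ≤ A * (A * A) :=
      (ContinuousLinearMap.le_of_opNorm_le _ (h.norm_V_le s hs) _).trans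
        (by gcongr; exact (h.norm_X_le s hs t ht).trans (by gcongr))
    have n3 := norm_act2_le_of_le h.dim_sq_le (norm_DVV_le h.derivBounds (h.norm_V_le s hs))
      ((h.norm_X2_le s hs t ht).trans (by gcongr : _ ≤ A ^ 2 * A ^ 2))
    have hA7 : A ≤ A ^ 7 := le_self_pow₀ hA (by norm_num)
    have hA7' : A ^ 3 ≤ A ^ 7 := pow_le_pow_right₀ hA (by norm_num)
    calc _ ≤ A + A + A * (A * A) + A * (A ^ 2 * (A ^ 2 * A ^ 2)) :=
          norm_sub_le_of_le (norm_sub_le_of_le n1 n2) n3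
      _ = 2 * A + A ^ 3 + A ^ 7 := by ring
      _ ≤ 4 * A ^ 7 * 1 := by linarith
      _ ≤ 4 * A ^ 7 * (M ^ 3 * |t - s| ^ min (3 * γ) 1) := by gcongr
      _ = _ := by rw [hMdef]; ring

/-- Once Z^# is bounded by K, the first-order remainders of V(Z) and of Z cost at most two further
powers of A, whence 3 A^2 K = 6144 c^3 A^24. -/
theorem controlledNorm_le (h : PathBounds 𝕏 V V₀ Z T A) (hγ : 1 / 4 < γ) (hγ' : γ ≤ 1 / 2)
    (hg : 𝕏.IsGeometric) (hV₀ : Continuous V₀) {z₀ : Vec m} (hZ : IsSolution 𝕏 V V₀ z₀ Z)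
    {c : ℝ} (hc₁ : 1 ≤ c) (hc : 1 + 2 * c * (1 / 2) ^ (min (3 * γ) 1 + γ) ≤ c) :
    controlledNorm 𝕏 0 T Z (fun t => V (Z t)) (fun t => DVV V (Z t))
        ≤ ENNReal.ofReal (6144 * c ^ 3 * A ^ 24) ∧
      controlledNorm1 𝕏 0 T Z (fun t => V (Z t))
        ≤ ENNReal.ofReal (6144 * c ^ 3 * A ^ 24) := by
  have hA := h.one_le
  have hD := h.derivBounds
  set K := 2048 * c ^ 3 * A ^ 22 with hKdef
  have hL : 6144 * c ^ 3 * A ^ 24 = 3 * A ^ 2 * K := by rw [hKdef]; ring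
  have hc3 : 1 ≤ c ^ 3 := one_le_pow₀ hc₁
  have hKn : ∀ n ≤ 22, 2 * A ^ n ≤ K := fun n hn => by
    have h1 : A ^ n ≤ A ^ 22 := pow_le_pow_right₀ hA hn
    have h2 : 0 ≤ A ^ 22 := by positivity
    nlinarith
  have hK0 : 0 ≤ K := by positivity
  have hA2 : 1 ≤ A ^ 2 := one_le_pow₀ hA
  have hA12 : A ≤ A ^ 2 := le_self_pow₀ hA (by norm_num)
  have hKL : K ≤ 3 * A ^ 2 * K := by nlinarith
  have k1 := hKn 1 (by norm_num)
  have k2 := hKn 2 (by norm_num)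
  have k3 := hKn 3 (by norm_num)
  have k5 := hKn 5 (by norm_num)
  have k6 := hKn 6 (by norm_num)
  have hAKK : A * K ≤ A ^ 2 * K := by gcongr
  have hK2 : K ≤ A ^ 2 * K := by nlinarith
  rw [pow_one] at k1
  rw [hL]
  have hR : ∀ s ∈ Set.Icc 0 T, ∀ t ∈ Set.Icc 0 T, s ≠ t →
      ‖rem2 𝕏 Z (fun t => V (Z t)) (fun t => DVV V (Z t)) s t‖ ≤ K * |t - s| ^ min (3 * γ) 1 :=
    fun s hs t ht hst => h.norm_rem2_le hγ hγ' hg hV₀ hZ hc₁ hc hs ht hst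
  have hpow : ∀ s t : ℝ, |t - s| ^ (2 * γ) = (|t - s| ^ γ) ^ 2 := fun s t => by
    rw [← Real.rpow_mul_natCast (abs_nonneg _), mul_comm]
    norm_num
  -- Since γ ≤ 1/2, ρ ≥ 2γ; the surplus power of |t - s| has exponent in [0, 1] and is at most A.
  have hρ : ∀ s ∈ Set.Icc 0 T, ∀ t ∈ Set.Icc 0 T, s ≠ t →
      |t - s| ^ min (3 * γ) 1 ≤ A * (|t - s| ^ γ) ^ 2 := fun s hs t ht hst => by
    have hpos : 0 < |t - s| := abs_pos.2 (sub_ne_zero.2 hst.symm)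
    rw [← hpow, show min (3 * γ) 1 = (min (3 * γ) 1 - 2 * γ) + 2 * γ by ring,
      Real.rpow_add hpos]
    gcongr
    refine h.abs_sub_rpow_le hs ht ?_ ?_
    · rw [sub_nonneg]
      exact le_min (by linarith) (by linarith)
    · linarith [min_le_right (3 * γ) 1]
  have s0 : supNorm (Set.Icc 0 T) Z ≤ ENNReal.ofReal (3 * A ^ 2 * K) :=
    supNorm_le fun s hs => (h.norm_Z_le s hs).trans (by linarith)
  have s1 : supNorm (Set.Icc 0 T) (fun t => V (Z t)) ≤ ENNReal.ofReal (3 * A ^ 2 * K) :=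
    supNorm_le fun s hs => (h.norm_V_le s hs).trans (by linarith)
  refine ⟨max_le s0 <| max_le s1 <| max_le ?_ <| max_le ?_ <| max_le ?_ ?_,
    max_le s0 <| max_le s1 <| max_le ?_ ?_⟩
  · exact supNorm_le fun s hs => (norm_DVV_le hD (h.norm_V_le s hs)).trans (by linarith)
  · refine holderNorm_le fun s hs t ht _ => ?_
    calc _ ≤ 2 * A ^ 2 * ‖Z t - Z s‖ := norm_DVV_sub_le hD (h.norm_V_le t ht)
      _ ≤ 2 * A ^ 2 * (A * |t - s| ^ γ) := by
          gcongr
          exact h.norm_incr_Z_le s hs t ht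
      _ = 2 * A ^ 3 * |t - s| ^ γ := by ring
      _ ≤ _ := mul_le_mul_of_nonneg_right (by linarith) (by positivity)
  · refine holderNorm_le fun s hs t ht hst => ?_
    have h1 := norm_rem1_V_le hA h.dim_sq_le hD (h.norm_V_le s hs)
      (h.norm_incr_Z_le s hs t ht) (h.norm_X2_le s hs t ht) (hR s hs t ht hst)
    rw [hpow]
    calc _ ≤ 2 * A ^ 6 * (|t - s| ^ γ) ^ 2 + A * (K * |t - s| ^ min (3 * γ) 1) := h1
      _ ≤ 2 * A ^ 6 * (|t - s| ^ γ) ^ 2 + A * (K * (A * (|t - s| ^ γ) ^ 2)) := by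
          gcongr
          exact hρ s hs t ht hst
      _ = (2 * A ^ 6 + A ^ 2 * K) * (|t - s| ^ γ) ^ 2 := by ring
      _ ≤ _ := by
          gcongr
          linarith
  · exact holderNorm_le fun s hs t ht hst => (hR s hs t ht hst).trans (by gcongr)
  · refine holderNorm_le fun s hs t ht _ => ?_
    calc _ ≤ A * ‖Z t - Z s‖ := hD.norm_sub_le _ _
      _ ≤ A * (A * |t - s| ^ γ) := by
          gcongr
          exact h.norm_incr_Z_le s hs t ht
      _ = A ^ 2 * |t - s| ^ γ := by ring
      _ ≤ _ := by
          gcongr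
          linarith
  · refine holderNorm_le fun s hs t ht hst => ?_
    have h1 := norm_first_remainder_le h.dim_sq_le hD (h.norm_V_le s hs)
      (h.norm_X2_le s hs t ht) (hR s hs t ht hst)
    rw [hpow]
    calc _ ≤ A ^ 5 * (|t - s| ^ γ) ^ 2 + K * |t - s| ^ min (3 * γ) 1 := h1
      _ ≤ A ^ 5 * (|t - s| ^ γ) ^ 2 + K * (A * (|t - s| ^ γ) ^ 2) := by
          gcongr
          exact hρ s hs t ht hst
      _ = (A ^ 5 + A * K) * (|t - s| ^ γ) ^ 2 := by ring
      _ ≤ _ := by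
          gcongr
          linarith

end PathBounds

/-! ### Polynomial dependence of the constants -/

/-- Growth of the coefficients of the equation along paths bounded by `B`. -/
theorem exists_pathBounds {d m : ℕ} {γ : ℝ} {V : Vec m → Vec d →L[ℝ] Vec m} {C : ℝ}
    (hV : ∀ A ≥ C, DerivBounds V A) {V₀ : Vec m → Vec m} {P : Polynomial ℝ}
    (hP : ∀ z, ‖V₀ z‖ ≤ P.eval ‖z‖) :
    ∃ (D : ℝ) (q : ℕ), ∀ (𝕏 : RoughPath d γ) (Z : ℝ → Vec m) (T B : ℝ), 1 ≤ B → T ≤ B →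
      𝕏.norm 0 T ≤ B → cHolderNorm γ (Set.Icc 0 T) Z ≤ ENNReal.ofReal B →
      PathBounds 𝕏 V V₀ Z T (D * B ^ q) := by
  set S := ∑ i ∈ Finset.range (P.natDegree + 1), |P.coeff i| with hS
  have hS0 : 0 ≤ S := Finset.sum_nonneg fun i _ => abs_nonneg _
  -- V grows linearly, so degree one suffices for it; V₀ needs the degree of P. The extra 1 in the
  -- exponent ensures B ≤ B^q even when P is constant.
  refine ⟨1 + |C| + ‖V 0‖ + (d : ℝ) ^ 2 + (d : ℝ) ^ 3 + S, P.natDegree + 1, ?_⟩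
  intro 𝕏 Z T B hB hTB hNB hZB
  set D := 1 + |C| + ‖V 0‖ + (d : ℝ) ^ 2 + (d : ℝ) ^ 3 + S with hD
  have hC0 := abs_nonneg C
  have hV0 := norm_nonneg (V 0)
  have hd2 : (0 : ℝ) ≤ (d : ℝ) ^ 2 := by positivity
  have hd3 : (0 : ℝ) ≤ (d : ℝ) ^ 3 := by positivity
  have hD1 : 1 ≤ D := by linarith
  have hBq : B ≤ B ^ (P.natDegree + 1) := le_self_pow₀ hB (by omega)
  have hDA : D * B ≤ D * B ^ (P.natDegree + 1) := by gcongr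
  have hDD : D ≤ D * B := le_mul_of_one_le_right (by linarith) hB
  have hBD : B ≤ D * B := le_mul_of_one_le_left (by linarith) hD1
  have hBA : B ≤ D * B ^ (P.natDegree + 1) := hBD.trans hDA
  have hN0 := 𝕏.norm_nonneg 0 T
  have hNA := hNB.trans hBA
  have hZ : ∀ s ∈ Set.Icc 0 T, ‖Z s‖ ≤ B := fun s hs =>
    norm_le_of_supNorm_le (by linarith) ((le_max_left _ _).trans hZB) hs
  exact
    { one_le := by linarith
      dim_sq_le := by linarith
      dim_cube_le := by linarith
      T_le := by linarith
      derivBounds := hV _ (by linarith [le_abs_self C])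
      norm_Z_le := fun s hs => (hZ s hs).trans hBA
      norm_V_le := fun s hs => by
        have h1 := (hV |C| (le_abs_self C)).norm_sub_le 0 (Z s)
        rw [sub_zero] at h1
        calc ‖V (Z s)‖ = ‖V 0 + (V (Z s) - V 0)‖ := by rw [add_sub_cancel]
          _ ≤ ‖V 0‖ + |C| * ‖Z s‖ := norm_add_le_of_le le_rfl h1
          _ ≤ ‖V 0‖ * B + |C| * B := by
              gcongr
              · exact le_mul_of_one_le_right hV0 hB
              · exact hZ s hs
          _ = (‖V 0‖ + |C|) * B := by ring
          _ ≤ D * B := by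
              gcongr
              linarith
          _ ≤ _ := hDA
      norm_V₀_le := fun s hs => by
        calc ‖V₀ (Z s)‖ ≤ P.eval ‖Z s‖ := hP _
          _ = ∑ i ∈ Finset.range (P.natDegree + 1), P.coeff i * ‖Z s‖ ^ i :=
              Polynomial.eval_eq_sum_range _
          _ ≤ ∑ i ∈ Finset.range (P.natDegree + 1), |P.coeff i| * B ^ (P.natDegree + 1) := by
              refine Finset.sum_le_sum fun i hi => ?_
              have hi' : i ≤ P.natDegree + 1 := (Finset.mem_range.1 hi).le
              have h2 : ‖Z s‖ ^ i ≤ B ^ (P.natDegree + 1) :=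
                (pow_le_pow_left₀ (norm_nonneg _) (hZ s hs) i).trans (pow_le_pow_right₀ hB hi')
              exact mul_le_mul (le_abs_self _) h2 (by positivity) (abs_nonneg _)
          _ = S * B ^ (P.natDegree + 1) := by rw [hS, Finset.sum_mul]
          _ ≤ D * B ^ (P.natDegree + 1) := by
              gcongr
              linarith
      norm_incr_Z_le := fun s hs t ht => by
        rcases eq_or_ne s t with rfl | hst
        · rw [sub_self, norm_zero]
          positivity
        · refine (norm_le_of_holderNorm_le (by linarith) ((le_max_right _ _).trans hZB) hs ht
            hst).trans ?_
          gcongr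
      norm_X_le := fun s hs t ht => (𝕏.norm_X_le hs ht).trans (by gcongr)
      norm_X2_le := fun s hs t ht => (𝕏.norm_X2_le hs ht).trans (by gcongr)
      norm_X3_le := fun s hs t ht => (𝕏.norm_X3_le hs ht).trans (by gcongr) }

/-- For θ > 1 the geometric series with ratio 2(1/2)^θ < 1 converges, and its sum is the fixed point
c. -/
theorem exists_sewing_constant {θ : ℝ} (hθ : 1 < θ) :
    ∃ c : ℝ, 1 ≤ c ∧ 1 + 2 * c * (1 / 2) ^ θ ≤ c := by
  have h : (1 / 2 : ℝ) ^ θ < 1 / 2 := by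
    calc (1 / 2 : ℝ) ^ θ < (1 / 2) ^ (1 : ℝ) :=
          Real.rpow_lt_rpow_of_exponent_gt (by norm_num) (by norm_num) hθ
      _ = 1 / 2 := Real.rpow_one _
  have h0 : 0 < (1 / 2 : ℝ) ^ θ := by positivity
  have h1 : 0 < 1 - 2 * (1 / 2 : ℝ) ^ θ := by linarith
  refine ⟨1 / (1 - 2 * (1 / 2 : ℝ) ^ θ), ?_, le_of_eq ?_⟩
  · rw [le_div_iff₀ h1]
    linarith
  · field_simp
    ring

end RoughDE

theorem proposition1p10 {d m : ℕ} (γ : ℝ) (hγ : 1 / 4 < γ) (hγ' : γ ≤ 1 / 2) (hγ3 : γ ≠ 1 / 3)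
    (p : ℝ) (hp : 1 / γ + 1 < p) (hp' : p ≤ (⌊1 / γ⌋ : ℝ) + 2)
    (V : RoughDE.Vec m → RoughDE.Vec d →L[ℝ] RoughDE.Vec m) (hV : RoughDE.IsLip p V)
    (V₀ : RoughDE.Vec m → RoughDE.Vec m) (hV₀ : ContDiff ℝ 1 V₀)
    (P : Polynomial ℝ) (hP : ∀ z, ‖V₀ z‖ ≤ P.eval ‖z‖)
    (R : MvPolynomial (Fin 2) ℝ) (Φ : ℝ → ℝ) (hΦ : Continuous Φ) :
    ∃ (Q : MvPolynomial (Fin 2) ℝ) (Ψ : ℝ → ℝ), Continuous Ψ ∧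
      ∀ 𝕏 : RoughDE.RoughPath d γ, 𝕏.IsGeometric →
      ∀ φ : RoughDE.Vec m → ℝ → RoughDE.Vec m,
        -- for every initial value, `φ z₀` is the unique solution
        (∀ z₀, RoughDE.IsSolution 𝕏 V V₀ z₀ (φ z₀) ∧
          ∀ Z, RoughDE.IsSolution 𝕏 V V₀ z₀ Z → Set.EqOn Z (φ z₀) (Set.Ici 0)) →
        -- the a priori bound
        (∀ z₀, ∀ T > 0, RoughDE.cHolderNorm γ (Set.Icc 0 T) (φ z₀) ≤
          ENNReal.ofReal (Φ T * MvPolynomial.eval ![‖z₀‖, 𝕏.norm 0 T] R)) →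
        ∀ z₀, ∀ T > 0,
          RoughDE.controlledNorm 𝕏 0 T (φ z₀) (fun t => V (φ z₀ t))
              (fun t => RoughDE.DVV V (φ z₀ t)) ≤
            ENNReal.ofReal (Ψ T * MvPolynomial.eval ![‖z₀‖, 𝕏.norm 0 T] Q) ∧
          (1 / 3 < γ →
            RoughDE.controlledNorm1 𝕏 0 T (φ z₀) (fun t => V (φ z₀ t)) ≤
              ENNReal.ofReal (Ψ T * MvPolynomial.eval ![‖z₀‖, 𝕏.norm 0 T] Q)) := by
  have hp3 : 3 ≤ p := by
    have : 2 ≤ 1 / γ := by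
      rw [le_div_iff₀ (by linarith)]
      linarith
    linarith
  obtain ⟨C, hC⟩ := hV.exists_derivBounds hp3
  obtain ⟨D, q, hDq⟩ := RoughDE.exists_pathBounds (γ := γ) hC hP
  -- The exponent is 4γ or 1 + γ, and γ > 1/4 makes both exceed 1.
  obtain ⟨c, hc₁, hc⟩ := RoughDE.exists_sewing_constant (θ := min (3 * γ) 1 + γ) (by
    rcases min_cases (3 * γ) 1 with h | h <;> rw [h.1] <;> linarith)
  -- The final bound is a multiple of (D B^q)^24 for a product B, so the factors depending on T go
  -- into Ψ and the others into Q. The polynomial 2 + R² replaces |R|, which is not a polynomial,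
  -- and is at least 1.
  refine ⟨((2 + R ^ 2) * (1 + MvPolynomial.X 1)) ^ (q * 24),
    fun T => 6144 * c ^ 3 * D ^ 24 * ((1 + |Φ T|) * (1 + |T|)) ^ (q * 24), by fun_prop, ?_⟩
  intro 𝕏 hg φ hφ hbound z₀ T hT
  have hN0 := 𝕏.norm_nonneg 0 T
  set N := 𝕏.norm 0 T with hN
  set r := MvPolynomial.eval ![‖z₀‖, N] R with hr
  have hQ : MvPolynomial.eval ![‖z₀‖, N] (((2 + R ^ 2) * (1 + MvPolynomial.X 1)) ^ (q * 24))
      = ((2 + r ^ 2) * (1 + N)) ^ (q * 24) := by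
    simp [hr]
  have h1 : 1 ≤ 1 + |Φ T| := by linarith [abs_nonneg (Φ T)]
  have h2 : 1 ≤ 1 + |T| := by linarith [abs_nonneg T]
  have h3 : 1 ≤ 2 + r ^ 2 := by nlinarith
  have h4 : 1 ≤ 1 + N := by linarith
  have h12 : 1 ≤ (1 + |Φ T|) * (1 + |T|) := one_le_mul_of_one_le_of_one_le h1 h2
  have h34 : 1 ≤ (2 + r ^ 2) * (1 + N) := one_le_mul_of_one_le_of_one_le h3 h4
  set B := (1 + |Φ T|) * (1 + |T|) * ((2 + r ^ 2) * (1 + N)) with hB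
  have hB1 : 1 ≤ B := one_le_mul_of_one_le_of_one_le h12 h34
  have hTB : T ≤ B := by
    calc T ≤ 1 + |T| := by linarith [le_abs_self T]
      _ ≤ (1 + |Φ T|) * (1 + |T|) := le_mul_of_one_le_left (by linarith) h1
      _ ≤ B := le_mul_of_one_le_right (by linarith) h34
  have hNB : N ≤ B := by
    calc N ≤ 1 + N := by linarith
      _ ≤ (2 + r ^ 2) * (1 + N) := le_mul_of_one_le_left (by linarith) h3
      _ ≤ B := le_mul_of_one_le_left (by linarith) h12
  have hΦB : Φ T * r ≤ B := by
    calc Φ T * r ≤ |Φ T * r| := le_abs_self _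
      _ = |Φ T| * |r| := abs_mul _ _
      _ ≤ (1 + |Φ T|) * (2 + r ^ 2) := by
          gcongr
          · linarith
          · nlinarith [sq_abs r, sq_nonneg (|r| - 1)]
      _ ≤ ((1 + |Φ T|) * (1 + |T|)) * ((2 + r ^ 2) * (1 + N)) := by
          gcongr
          · exact le_mul_of_one_le_right (by linarith) h2
          · exact le_mul_of_one_le_right (by linarith) h4
  have hpb := hDq 𝕏 (φ z₀) T B hB1 hTB hNB
    ((hbound z₀ T hT).trans (ENNReal.ofReal_le_ofReal hΦB))
  have hfin := hpb.controlledNorm_le hγ hγ' hg hV₀.continuous (hφ z₀).1 hc₁ hc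
  have e : 6144 * c ^ 3 * (D * B ^ q) ^ 24
      = 6144 * c ^ 3 * D ^ 24 * ((1 + |Φ T|) * (1 + |T|)) ^ (q * 24)
        * ((2 + r ^ 2) * (1 + N)) ^ (q * 24) := by
    rw [mul_pow D, ← pow_mul, hB, mul_pow ((1 + |Φ T|) * (1 + |T|))]
    ring
  rw [hQ]
  rw [e] at hfin
  exact ⟨hfin.1, fun _ => hfin.2⟩
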